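/- Setting. A source $M$ is a real random variable with law $P$. An encoder applies a Borel function $\gamma^e:\mathbb R\to\mathbb R$ to $M$, and a decoder applies a Borel function $\gamma^d:\mathbb R\to\mathbb R$ to the message, giving the action $U=\gamma^d(\gamma^e(M))$. For a bias $b\in\mathbb R$ the costs are $J^e=\mathbb E[(M-U-b)^2]$ and $J^d=\mathbb E[(M-U)^2]$. The pair $(\gamma^e,\gamma^d)$ is an equilibrium (Nash) if neither player can lower its own cost by switching to another Borel policy while the other player's policy is kept. Let the support of $M$ be an interval with end points $m_0<m_N$ in $[-\infty,\infty]$. An equilibrium has $N$ bins, with edges $m_0<m_1<\dots<m_N$ and pairwise distinct actions $u_1,\dots,u_N$, if $U=u_k$ almost surely on $\{m_{k-1}\le M<m_k\}$ for $k=1,\dots,N$. "A unique equilibrium with $N$ bins" means that there is exactly one family of edges $(m_k)$ and actions $(u_k)$ that arises from an equilibrium with $N$ bins. (Policies are thus identified when they differ only in the labels of messages, on null sets, or in the reaction to messages that are not sent.) Theorem. Let $M$ have a density $f$ that is log-concave ($\log f$ is concave on the interval $\{f>0\}$), and let $M$ have a finite mean. (i) Suppose that the support of $f$ (the closure of $\{f>0\}$)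 is $[m_L,\infty)$ for some $m_L\in\mathbb R$. If $b>0$, then for every integer $N\ge1$ there is a unique equilibrium with $N$ bins. If $b<0$, then there is an integer $N_{\max}(b)\ge1$ such that every equilibrium has a finite number of bins, which is at most $N_{\max}(b)$, and for each $1\le N\le N_{\max}(b)$ there is a unique equilibrium with $N$ bins. (ii) Suppose that the support of $f$ is $(-\infty,m_U]$ for some $m_U\in\mathbb R$. If $b<0$, then for every integer $N\ge1$ there is a unique equilibrium with $N$ bins. If $b>0$, then there is an integer $N_{\max}(b)\ge1$ such that every equilibrium has a finite number of bins, which is at most $N_{\max}(b)$, and for each $1\le N\le N_{\max}(b)$ there is a unique equilibrium with $N$ bins. -/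

import Mathlib

open MeasureTheory Set

/-- `f` is a probability density on `ℝ` whose logarithm is concave on the set where `f` is nonzero
(concavity on a set includes convexity of that set). -/
structure IsLogConcaveDensity (f : ℝ → ℝ) : Prop where
  nonneg : ∀ x, 0 ≤ f x
  measurable : Measurable f
  total_mass : ∫⁻ x, ENNReal.ofReal (f x) = 1
  log_concave : ConcaveOn ℝ (Function.support f) (fun x => Real.log (f x))

/-- The law of a source `M` with density `f`. -/
noncomputable def sourceLaw (f : ℝ → ℝ) : Measure ℝ :=
  volume.withDensity (fun x => ENNReal.ofReal (f x))

/-- The expected encoder cost `E[(M - U - b)²]`, where `U = γd (γe M)` and `M` has law `P`. -/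
noncomputable def encoderCost (P : Measure ℝ) (b : ℝ) (γe γd : ℝ → ℝ) : ENNReal :=
  ∫⁻ x, ENNReal.ofReal ((x - γd (γe x) - b) ^ 2) ∂P

/-- The expected decoder cost `E[(M - U)²]`, where `U = γd (γe M)` and `M` has law `P`. -/
noncomputable def decoderCost (P : Measure ℝ) (γe γd : ℝ → ℝ) : ENNReal :=
  ∫⁻ x, ENNReal.ofReal ((x - γd (γe x)) ^ 2) ∂P

/-- Nash equilibrium of the simultaneous-move cheap talk game with bias `b`: both policies are
Borel measurable, and neither player gains by deviating to another Borel measurable policy. -/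
structure IsNashEquilibrium (P : Measure ℝ) (b : ℝ) (γe γd : ℝ → ℝ) : Prop where
  measurable_encoder : Measurable γe
  measurable_decoder : Measurable γd
  encoder_optimal : ∀ γ : ℝ → ℝ, Measurable γ → encoderCost P b γe γd ≤ encoderCost P b γ γd
  decoder_optimal : ∀ γ : ℝ → ℝ, Measurable γ → decoderCost P γe γd ≤ decoderCost P γe γ

/-- The bin `[m k, m (k + 1))` cut out by the (possibly infinite) bin edges `m`. -/
def bin {N : ℕ} (m : Fin (N + 1) → EReal) (k : Fin N) : Set ℝ :=
  {x : ℝ | m k.castSucc ≤ (x : EReal) ∧ (x : EReal) < m k.succ}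

/-- Under the policies `γe`, `γd` the source range from `lo` to `hi` is quantized into the `N` bins
with edges `lo = m 0 < m 1 < ⋯ < m N = hi`: almost surely the decoder takes the action `u k` when
the source is in bin `k`, and different bins have different actions. -/
structure HasBins (P : Measure ℝ) (lo hi : EReal) (γe γd : ℝ → ℝ) {N : ℕ}
    (m : Fin (N + 1) → EReal) (u : Fin N → ℝ) : Prop where
  edge_first : m 0 = lo
  edge_last : m (Fin.last N) = hi
  edge_strictMono : StrictMono m
  action_injective : Function.Injective u
  action_eq : ∀ k : Fin N, ∀ᵐ x ∂P, x ∈ bin m k → γd (γe x) = u k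

/-- The edges `m` and the actions `u` describe an equilibrium with `N` bins. -/
def IsBinEquilibrium (P : Measure ℝ) (b : ℝ) (lo hi : EReal) {N : ℕ}
    (m : Fin (N + 1) → EReal) (u : Fin N → ℝ) : Prop :=
  ∃ γe γd : ℝ → ℝ, IsNashEquilibrium P b γe γd ∧ HasBins P lo hi γe γd m u

/-- There is a unique equilibrium with `N` bins: unique bin edges and unique decoder actions. -/
def HasUniqueEquilibrium (P : Measure ℝ) (b : ℝ) (lo hi : EReal) (N : ℕ) : Prop :=
  ∃! q : (Fin (N + 1) → EReal) × (Fin N → ℝ), IsBinEquilibrium P b lo hi q.1 q.2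

/-- `Nmax` is an upper bound on the number of bins: no equilibrium has infinitely many bins, and
none has more than `Nmax` bins. -/
def IsBinBound (P : Measure ℝ) (b : ℝ) (lo hi : EReal) (Nmax : ℕ) : Prop :=
  (∀ γe γd : ℝ → ℝ, IsNashEquilibrium P b γe γd →
    ∃ (N : ℕ) (m : Fin (N + 1) → EReal) (u : Fin N → ℝ), HasBins P lo hi γe γd m u) ∧
  (∀ (N : ℕ) (m : Fin (N + 1) → EReal) (u : Fin N → ℝ),
    IsBinEquilibrium P b lo hi m u → N ≤ Nmax)

/-! An equilibrium with bins is the same as a list of edges for which each action is the centroid of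
its bin (decoder optimality) and each interior edge `y` between actions `u < v` satisfies `y = (u +
v) / 2 + b` (encoder indifference). `CentroidBins.of_isBinEquilibrium` and
`CentroidBins.isBinEquilibrium` give the two directions.

On a half-line `[L, ∞)` these conditions form a recursion started from the infinite last bin. If a
chain with `n` edges starts at `x`, let `e` be the distance from `x` to its first centroid.
Log-concavity enters mainly through one fact: translating an interval to the right moves its
centroid by at most the same amount. From it `BinChain.compare` shows by induction that `e` is
nonincreasing and `x + e` nondecreasing in `x`. Hence `e` is determined by `x` and is 1-Lipschitz.
The defect `y - c x y - e(y) - 2b` is then continuous and strictly increasing in the next edge `y`,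
so at most one `y` works (`BinChain.edge_eq`), and the intermediate value theorem produces one once
the sign changes (`BinChain.exists_cons`).

For `b > 0` the sign always changes, so every length occurs. For `b < 0` a chain from a point yields
one of the same length from every point to its left (`BinChain.exists_of_le`), so the admissible
lengths form an initial segment. It is bounded: where the density decreases, a centroid lies left of
the midpoint, which forces the offsets `e` to grow by at least `-2b` per bin, while the mean
residual bounds them.

To exclude infinitely many bins when `b < 0`, arbitrary equilibria are examined directly: distinct
actions are at least `-2b` apart, and the same growth argument in the tail leaves finitely many
(`usedActions_finite`). The half-line unbounded to the left follows by the reflection `x ↦ -x`,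
which flips the sign of `b`. -/

/-! ### Axioms for centroids and their monotonicity consequences. -/

/-- The properties of the centroid `c x y` of a log-concave density on `(x, y)` and of its mean
residual `r x`, for `x ≥ L`, on which the analysis of bin edges rests. -/
structure CentroidSystem (L : ℝ) (c : ℝ → ℝ → ℝ) (r : ℝ → ℝ) : Prop where
  left_lt : ∀ {x y}, L ≤ x → x < y → x < c x y
  lt_right : ∀ {x y}, L ≤ x → x < y → c x y < y
  strict_left : ∀ {x x' y}, L ≤ x → x < x' → x' < y → c x y < c x' y
  strict_right : ∀ {x y y'}, L ≤ x → x < y → y < y' → c x y < c x y'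
  shift : ∀ {x y s}, L ≤ x → x < y → 0 ≤ s → c (x + s) (y + s) ≤ c x y + s
  tail_pos : ∀ {x}, L ≤ x → 0 < r x
  lt_tail : ∀ {x y}, L ≤ x → x < y → c x y < x + r x
  tail_anti : ∀ {x x'}, L ≤ x → x ≤ x' → r x' ≤ r x
  tail_mono : ∀ {x x'}, L ≤ x → x ≤ x' → x + r x ≤ x' + r x'

/-- `BinChain b c r n x e`: the half-line starting at `x` can be cut by `n` edges into bins whose
centroids satisfy the indifference condition at each edge, and the first centroid is `x + e`. -/
inductive BinChain (b : ℝ) (c : ℝ → ℝ → ℝ) (r : ℝ → ℝ) : ℕ → ℝ → ℝ → Prop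
  | last (x : ℝ) : BinChain b c r 0 x (r x)
  | cons {n : ℕ} {x y e : ℝ} (hxy : x < y) (h : BinChain b c r n y e)
      (he : y - c x y = e + 2 * b) : BinChain b c r (n + 1) x (c x y - x)

namespace CentroidSystem

variable {L b : ℝ} {c : ℝ → ℝ → ℝ} {r : ℝ → ℝ}

lemma mono_left (H : CentroidSystem L c r) {x x' y : ℝ} (hx : L ≤ x) (h : x ≤ x') (hy : x' < y) :
    c x y ≤ c x' y := by
  rcases h.eq_or_lt with rfl | h
  · exact le_rfl
  · exact (H.strict_left hx h hy).le

lemma mono_right (H : CentroidSystem L c r) {x y y' : ℝ} (hx : L ≤ x) (hy : x < y) (h : y ≤ y') :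
    c x y ≤ c x y' := by
  rcases h.eq_or_lt with rfl | h
  · exact le_rfl
  · exact (H.strict_right hx hy h).le

/-- Translating the whole interval by `y' - y` does not increase the distance from centroid to right
end; moving the left end back to `x` then strictly increases it. -/
lemma sub_strictMono (H : CentroidSystem L c r) {x y y' : ℝ} (hx : L ≤ x) (hy : x < y)
    (h : y < y') : y - c x y < y' - c x y' := by
  have h1 := H.strict_left (x' := x + (y' - y)) (y := y') hx (by linarith) (by linarith)
  have h2 := H.shift (s := y' - y) hx hy (by linarith)
  rw [show y + (y' - y) = y' by ring] at h2
  linarith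

lemma sub_mono (H : CentroidSystem L c r) {x y y' : ℝ} (hx : L ≤ x) (hy : x < y)
    (h : y ≤ y') : y - c x y ≤ y' - c x y' := by
  rcases h.eq_or_lt with rfl | h
  · exact le_rfl
  · exact (H.sub_strictMono hx hy h).le

/-- The hypothesis `h` is what the induction in `compare` supplies: an edge further left has a
larger offset. With `y' < y` it would make the right part of the bin `(x, y)` both no larger and
strictly larger than that of `(x', y')`. -/
lemma edge_le (H : CentroidSystem L c r) {x x' y y' e e' : ℝ} (hx : L ≤ x) (hxx : x ≤ x')
    (hy' : x' < y') (he : y - c x y = e + 2 * b) (he' : y' - c x' y' = e' + 2 * b)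
    (h : y' ≤ y → e ≤ e') : y ≤ y' := by
  by_contra! hlt
  have h1 := h hlt.le
  have h2 := H.mono_left hx hxx hy'
  have h3 := H.sub_strictMono hx (hxx.trans_lt hy') hlt
  linarith

/-- Compare `(x', y')` with the translate of `(x, y)` that starts at `x'`. A larger left part would
force `y'` beyond the translated right end, hence a larger right part, contradicting `e' ≤ e`. -/
lemma first_le (H : CentroidSystem L c r) {x x' y y' e e' : ℝ} (hx : L ≤ x) (hxx : x ≤ x')
    (hy : x < y) (hy' : x' < y') (he : y - c x y = e + 2 * b) (he' : y' - c x' y' = e' + 2 * b)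
    (h : e' ≤ e) : c x' y' - x' ≤ c x y - x := by
  by_contra! hlt
  have h1 := H.shift (s := x' - x) hx hy (by linarith)
  rw [show x + (x' - x) = x' by ring] at h1
  have h2 : y + (x' - x) < y' := by
    by_contra! h2
    have := H.mono_right (hx.trans hxx) hy' h2
    linarith
  have h3 := H.sub_strictMono (hx.trans hxx) (by linarith) h2
  linarith

end CentroidSystem

/-! ### Comparison, uniqueness, existence and length of chains. -/

namespace BinChain

variable {L b : ℝ} {c : ℝ → ℝ → ℝ} {r : ℝ → ℝ}

/-- The two monotonicities together say that the offset is a 1-Lipschitz nonincreasing function of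
the starting point; each is needed to carry the induction and the continuity argument. -/
lemma compare (H : CentroidSystem L c r) {n : ℕ} : ∀ {x x' e e' : ℝ}, BinChain b c r n x e →
    BinChain b c r n x' e' → L ≤ x → x ≤ x' → e' ≤ e ∧ x + e ≤ x' + e' := by
  induction n with
  | zero =>
    intro x x' e e' h h' hx hxx
    cases h
    cases h'
    exact ⟨H.tail_anti hx hxx, H.tail_mono hx hxx⟩
  | succ n ih =>
    intro x x' e e' h h' hx hxx
    cases h with
    | @cons _ _ y e₁ hxy h he =>
    cases h' with
    | @cons _ _ y' e₁' hxy' h' he' =>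
    have hyy : y ≤ y' := H.edge_le hx hxx hxy' he he'
      fun hle => (ih h' h (by linarith) hle).1
    have h1 := H.first_le hx hxx hxy hxy' he he' (ih h h' (by linarith) hyy).1
    have h2 := H.mono_right hx hxy hyy
    have h3 := H.mono_left hx hxx hxy'
    exact ⟨h1, by linarith⟩

lemma eq_of_start (H : CentroidSystem L c r) {n : ℕ} {x e e' : ℝ} (h : BinChain b c r n x e)
    (h' : BinChain b c r n x e') (hx : L ≤ x) : e = e' :=
  le_antisymm (h'.compare H h hx le_rfl).1 (h.compare H h' hx le_rfl).1

lemma edge_eq (H : CentroidSystem L c r) {n : ℕ} {x y y' e e' : ℝ} (hx : L ≤ x) (hy : x < y)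
    (hy' : x < y') (h : BinChain b c r n y e) (h' : BinChain b c r n y' e')
    (he : y - c x y = e + 2 * b) (he' : y' - c x y' = e' + 2 * b) : y = y' :=
  le_antisymm
    (H.edge_le hx le_rfl hy' he he' fun hle => (h'.compare H h (by linarith) hle).1)
    (H.edge_le hx le_rfl hy he' he fun hle => (h.compare H h' (by linarith) hle).1)

lemma pos (H : CentroidSystem L c r) {n : ℕ} {x e : ℝ} (h : BinChain b c r n x e) (hx : L ≤ x) :
    0 < e := by
  cases h with
  | last => exact H.tail_pos hx
  | cons hxy h he => linarith [H.left_lt hx hxy]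

lemma le_tail (H : CentroidSystem L c r) {n : ℕ} {x e : ℝ} (h : BinChain b c r n x e)
    (hx : L ≤ x) : e ≤ r x := by
  cases h with
  | last => exact le_rfl
  | cons hxy h he => linarith [H.lt_tail hx hxy]

/-- If chains with `n` edges start from all points of `[y₀, y₁]`, and the indifference defect
changes sign there, then a chain with `n + 1` edges starts from `x`. -/
lemma exists_cons (H : CentroidSystem L c r) {n : ℕ} {x y₀ y₁ : ℝ} (hx : L ≤ x) (h₀ : x < y₀)
    (h₀₁ : y₀ ≤ y₁) (hex : ∀ y ∈ Icc y₀ y₁, ∃ e, BinChain b c r n y e)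
    (hlo : ∀ e, BinChain b c r n y₀ e → y₀ - c x y₀ ≤ e + 2 * b)
    (hhi : ∀ e, BinChain b c r n y₁ e → e + 2 * b ≤ y₁ - c x y₁) :
    ∃ e, BinChain b c r (n + 1) x e := by
  choose! E hE using hex
  have hElip : ∀ y ∈ Icc y₀ y₁, ∀ y' ∈ Icc y₀ y₁, y ≤ y' →
      E y' ≤ E y ∧ y + E y ≤ y' + E y' := fun y hy y' hy' hle =>
    (hE y hy).compare H (hE y' hy') (by linarith [hy.1]) hle
  have hEc : ContinuousOn E (Icc y₀ y₁) := by
    refine LipschitzOnWith.continuousOn (K := 1) (LipschitzOnWith.of_dist_le_mul ?_)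
    intro y hy y' hy'
    rw [Real.dist_eq, Real.dist_eq, NNReal.coe_one, one_mul, abs_le]
    rcases le_total y y' with hle | hle
    · have := hElip y hy y' hy' hle
      rw [abs_of_nonpos (by linarith)]
      constructor <;> linarith
    · have := hElip y' hy' y hy hle
      rw [abs_of_nonneg (by linarith)]
      constructor <;> linarith
  have hcc : ContinuousOn (c x) (Icc y₀ y₁) := by
    refine LipschitzOnWith.continuousOn (K := 1) (LipschitzOnWith.of_dist_le_mul ?_)
    intro y hy y' hy'
    rw [Real.dist_eq, Real.dist_eq, NNReal.coe_one, one_mul, abs_le]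
    rcases le_total y y' with hle | hle
    · have h1 := H.mono_right hx (h₀.trans_le hy.1) hle
      have h2 := H.sub_mono hx (h₀.trans_le hy.1) hle
      rw [abs_of_nonpos (by linarith)]
      constructor <;> linarith
    · have h1 := H.mono_right hx (h₀.trans_le hy'.1) hle
      have h2 := H.sub_mono hx (h₀.trans_le hy'.1) hle
      rw [abs_of_nonneg (by linarith)]
      constructor <;> linarith
  have hcont : ContinuousOn (fun y => y - c x y - (E y + 2 * b)) (Icc y₀ y₁) := by fun_prop
  have hmem : (0 : ℝ) ∈ Icc (y₀ - c x y₀ - (E y₀ + 2 * b)) (y₁ - c x y₁ - (E y₁ + 2 * b)) :=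
    ⟨by linarith [hlo _ (hE y₀ (left_mem_Icc.2 h₀₁))],
      by linarith [hhi _ (hE y₁ (right_mem_Icc.2 h₀₁))]⟩
  obtain ⟨y, hy, hy0⟩ := intermediate_value_Icc h₀₁ hcont hmem
  exact ⟨_, BinChain.cons (h₀.trans_le hy.1) (hE y hy) (sub_eq_zero.1 hy0)⟩

lemma exists_of_le (H : CentroidSystem L c r) {n : ℕ} : ∀ {x x' e : ℝ}, BinChain b c r n x' e →
    L ≤ x → x ≤ x' → ∃ e', BinChain b c r n x e' := by
  induction n with
  | zero => exact fun _ _ _ => ⟨_, BinChain.last _⟩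
  | succ n ih =>
    intro x x' e h hx hxx
    cases h with
    | @cons _ _ y e hxy h he =>
    have h1 := H.lt_right (hx.trans hxx) hxy
    have h2 := H.left_lt (hx.trans hxx) hxy
    -- At this `y₀` even the full length `y₀ - x` equals the right part `y - c x' y = e + 2b` of the
    -- given bin, and offsets at `y₀ ≤ y` are at least `e`. At `y₁ = y` the longer bin `(x, y)` has
    -- the larger right part.
    refine exists_cons H (y₀ := x + (y - c x' y)) (y₁ := y) hx (by linarith) (by linarith)
      (fun z hz => ih h (by linarith [hz.1]) hz.2) (fun e₁ h₁ => ?_) (fun e₁ h₁ => ?_)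
    · have h3 := (h₁.compare H h (by linarith) (by linarith)).1
      have h4 := H.left_lt (y := x + (y - c x' y)) hx (by linarith)
      linarith
    · have h3 := h₁.eq_of_start H h (by linarith)
      have h4 := H.mono_left hx hxx hxy
      linarith

lemma exists_of_pos (H : CentroidSystem L c r) (hb : 0 < b) (n : ℕ) : ∀ {x : ℝ}, L ≤ x →
    ∃ e, BinChain b c r n x e := by
  induction n with
  | zero => exact fun _ => ⟨_, BinChain.last _⟩
  | succ n ih =>
    intro x hx
    have hr := H.tail_pos hx
    -- A bin of length `2b` has right part below `2b`. At `y₁` the centroid is below `x + r x`, so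
    -- the right part exceeds `2b + r x`, and offsets never exceed `r x`.
    refine exists_cons H (y₀ := x + 2 * b) (y₁ := x + 2 * b + 2 * r x) hx (by linarith)
      (by linarith) (fun z hz => ih (by linarith [hz.1])) (fun e h => ?_) (fun e h => ?_)
    · have h1 := h.pos H (by linarith)
      have h2 := H.left_lt (y := x + 2 * b) hx (by linarith)
      linarith
    · have h1 := h.le_tail H (by linarith)
      have h2 := H.tail_anti (x' := x + 2 * b + 2 * r x) hx (by linarith)
      have h3 := H.lt_tail (y := x + 2 * b + 2 * r x) hx (by linarith)
      linarith

/-- Dropping the first bin leaves a chain from a point right of `L`, which `exists_of_le` carries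
back to `L`. -/
lemma exists_of_succ (H : CentroidSystem L c r) {n : ℕ} {e : ℝ} (h : BinChain b c r (n + 1) L e) :
    ∃ e', BinChain b c r n L e' := by
  cases h with
  | cons hxy h he => exact h.exists_of_le H le_rfl hxy.le

lemma exists_of_le_length (H : CentroidSystem L c r) {n k : ℕ} (hk : k ≤ n) :
    (∃ e, BinChain b c r n L e) → ∃ e', BinChain b c r k L e' := by
  induction hk with
  | refl => exact id
  | step _ ih => exact fun ⟨_, h⟩ => ih (h.exists_of_succ H)

/-- A centroid left of the midpoint gives `c x y - x ≤ y - c x y = e + 2 * b`, so for negative `b`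
each step to the right raises the offset by at least `-2b`. -/
lemma length_bound_tail (H : CentroidSystem L c r) {X : ℝ} (hLX : L ≤ X)
    (hX : ∀ {x y}, X ≤ x → x < y → c x y ≤ (x + y) / 2) {n : ℕ} : ∀ {x e : ℝ},
    BinChain b c r n x e → X ≤ x → -2 * b * n + e ≤ r L := by
  induction n with
  | zero =>
    intro x e h hx
    have h1 := h.le_tail H (hLX.trans hx)
    have h2 := H.tail_anti le_rfl (hLX.trans hx)
    simpa using h1.trans h2
  | succ n ih =>
    intro x e h hx
    cases h with
    | @cons _ _ y e hxy h he =>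
    have h1 := ih h (by linarith)
    have h2 := hX hx hxy
    push_cast
    linarith

/-- Before `X` the growth is paid for by the distance `X - x` still to be covered; the bin crossing
`X` costs one more mean residual. -/
lemma length_bound (H : CentroidSystem L c r) {X : ℝ} (hLX : L ≤ X)
    (hX : ∀ {x y}, X ≤ x → x < y → c x y ≤ (x + y) / 2) {n : ℕ} : ∀ {x e : ℝ},
    BinChain b c r n x e → L ≤ x → x ≤ X → -2 * b * n + e ≤ 2 * r L + (X - x) := by
  induction n with
  | zero =>
    intro x e h hx hxX
    have h1 := h.le_tail H hx
    have h2 := H.tail_anti le_rfl hx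
    have h3 := H.tail_pos (le_refl L)
    simp only [Nat.cast_zero, mul_zero, zero_add]
    linarith
  | succ n ih =>
    intro x e h hx hxX
    have h0 := h.le_tail H hx
    cases h with
    | @cons _ _ y e hxy h he =>
    have h1 := H.lt_right hx hxy
    have h2 := H.tail_anti le_rfl hx
    push_cast
    rcases le_total y X with hy | hy
    · linarith [ih h (by linarith) hy]
    · linarith [length_bound_tail H hLX hX h hy]

end BinChain

/-! ### Tail decay and moments of a log-concave density on a half-line. -/

namespace IsLogConcaveDensity

variable {f : ℝ → ℝ} {L : ℝ}

lemma pos_of_lt (hf : IsLogConcaveDensity f) (hL : tsupport f = Ici L) {x : ℝ} (hx : L < x) :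
    0 < f x := by
  have hd : ∀ y : ℝ, L ≤ y → ∀ ε > 0, ∃ z ∈ Function.support f, |y - z| < ε := fun y hy ε hε => by
    have : y ∈ closure (Function.support f) := by
      change y ∈ tsupport f
      rw [hL]
      exact hy
    simpa [Real.dist_eq] using Metric.mem_closure_iff.1 this ε hε
  obtain ⟨z, hz, hz'⟩ := hd L le_rfl (x - L) (by linarith)
  obtain ⟨w, hw, hw'⟩ := hd (x + 1) (by linarith) 1 one_pos
  have hxs : x ∈ Function.support f := hf.log_concave.1.ordConnected.out hz hw
    ⟨by linarith [(abs_lt.1 hz').1], by linarith [(abs_lt.1 hw').2]⟩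
  exact lt_of_le_of_ne (hf.nonneg x) (Ne.symm hxs)

lemma eq_zero_of_lt (hL : tsupport f = Ici L) {x : ℝ} (hx : x < L) : f x = 0 := by
  by_contra h
  have : x ∈ tsupport f := subset_tsupport f h
  rw [hL] at this
  exact absurd hx (not_lt.2 this)

lemma concaveOn_log (hf : IsLogConcaveDensity f) (hL : tsupport f = Ici L) :
    ConcaveOn ℝ (Ioi L) (fun x => Real.log (f x)) :=
  hf.log_concave.subset (fun _ hx => (hf.pos_of_lt hL hx).ne') (convex_Ioi L)

lemma integrable (hf : IsLogConcaveDensity f) : Integrable f := by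
  refine ⟨hf.measurable.aestronglyMeasurable, ?_⟩
  rw [hasFiniteIntegral_iff_ofReal (Filter.Eventually.of_forall hf.nonneg), hf.total_mass]
  exact ENNReal.one_lt_top

/-- This is the monotone likelihood ratio property: `f (t + s) / f t` is nonincreasing in `t`. -/
lemma mul_shift_le (hf : IsLogConcaveDensity f) (hL : tsupport f = Ici L) {x y s : ℝ} (hx : L < x)
    (hxy : x ≤ y) (hs : 0 ≤ s) : f x * f (y + s) ≤ f (x + s) * f y := by
  rcases (add_nonneg (sub_nonneg.2 hxy) hs).eq_or_lt with h0 | h0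
  · obtain rfl : y = x := by linarith
    obtain rfl : s = 0 := by linarith
    simp
  have h1 := hf.pos_of_lt hL hx
  have h2 := hf.pos_of_lt hL (x := y) (by linarith)
  have h3 := hf.pos_of_lt hL (x := x + s) (by linarith)
  have h4 := hf.pos_of_lt hL (x := y + s) (by linarith)
  rw [← Real.log_le_log_iff (by positivity) (by positivity), Real.log_mul h1.ne' h4.ne',
    Real.log_mul h3.ne' h2.ne']
  have hc := (hf.concaveOn_log hL).2 (x := x) hx (y := y + s) (by simp; linarith)
  -- With this weight, `x + s` and `y` are the convex combinations of `x` and `y + s` with weights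
  -- `(1 - t, t)` and `(t, 1 - t)`; adding the two concavity inequalities cancels `t`.
  set t := s / (y - x + s) with ht
  have ht0 : 0 ≤ t := by positivity
  have ht1 : t ≤ 1 := (div_le_one h0).2 (by linarith)
  have hts : t * (y - x + s) = s := by rw [ht]; field_simp
  have e1 := hc (a := 1 - t) (b := t) (by linarith) ht0 (by ring)
  have e2 := hc (a := t) (b := 1 - t) ht0 (by linarith) (by ring)
  simp only [smul_eq_mul] at e1 e2
  rw [show (1 - t) * x + t * (y + s) = x + s by linear_combination hts] at e1
  rw [show t * x + (1 - t) * (y + s) = y by linear_combination -hts] at e2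
  linarith

/-- A density nondecreasing on all of `(L, ∞)` would have infinite mass. -/
lemma exists_lt (hf : IsLogConcaveDensity f) (hL : tsupport f = Ici L) :
    ∃ x y, L < x ∧ x < y ∧ f y < f x := by
  by_contra! h
  have h1 := hf.pos_of_lt hL (x := L + 1) (by linarith)
  have h2 : ∫⁻ _ in Ioi (L + 1), ENNReal.ofReal (f (L + 1)) ≤ 1 := by
    rw [← hf.total_mass]
    refine (setLIntegral_mono' measurableSet_Ioi fun x hx => ?_).trans
      (setLIntegral_le_lintegral (Ioi (L + 1)) _)
    exact ENNReal.ofReal_le_ofReal (h _ _ (by linarith) hx)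
  rw [setLIntegral_const, Real.volume_Ioi, ENNReal.mul_top (by simpa using h1)] at h2
  exact absurd h2 (by simp)

/-- Past one strict descent from `x₀` to `x₁`, concavity keeps every slope of `log f` at or below
the negative slope `-κ` found there. -/
lemma exists_tail (hf : IsLogConcaveDensity f) (hL : tsupport f = Ici L) :
    ∃ X, L < X ∧ AntitoneOn f (Ici X) ∧
      ∃ κ > 0, ∃ C : ℝ, ∀ x, X ≤ x → f x ≤ C * Real.exp (-κ * x) := by
  obtain ⟨x₀, x₁, h0, h01, hlt⟩ := hf.exists_lt hL
  have p0 := hf.pos_of_lt hL h0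
  have p1 := hf.pos_of_lt hL (h0.trans h01)
  have hc := hf.concaveOn_log hL
  set κ := (Real.log (f x₀) - Real.log (f x₁)) / (x₁ - x₀) with hκ
  have hκ0 : 0 < κ := div_pos (sub_pos.2 (Real.log_lt_log p1 hlt)) (by linarith)
  have key : ∀ x y, x₁ ≤ x → x < y → Real.log (f y) - Real.log (f x) ≤ -κ * (y - x) := by
    intro x y hx hxy
    have h1 : (Real.log (f y) - Real.log (f x)) / (y - x) ≤
        (Real.log (f x₁) - Real.log (f x₀)) / (x₁ - x₀) := by
      rcases hx.eq_or_lt with rfl | hx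
      · exact hc.slope_anti_adjacent h0 (by simp; linarith) h01 hxy
      · exact (hc.slope_anti_adjacent (y := x) (by simp; linarith) (by simp; linarith) hx hxy).trans
          (hc.slope_anti_adjacent h0 (by simp; linarith) h01 hx)
    rw [div_le_iff₀ (by linarith)] at h1
    refine h1.trans_eq ?_
    rw [hκ, ← neg_div, neg_sub]
  refine ⟨x₁, h0.trans h01, ?_, κ, hκ0, f x₁ * Real.exp (κ * x₁), ?_⟩
  · intro x hx y hy hxy
    rcases hxy.eq_or_lt with rfl | hxy
    · exact le_rfl
    have := key x y hx hxy
    rw [← Real.log_le_log_iff (hf.pos_of_lt hL (by linarith [mem_Ici.1 hy]))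
      (hf.pos_of_lt hL (by linarith [mem_Ici.1 hx]))]
    nlinarith
  · intro x hx
    rw [mul_assoc, ← Real.exp_add]
    have p := hf.pos_of_lt hL (x := x) (by linarith)
    have : Real.log (f x) ≤ Real.log (f x₁) + (κ * x₁ + -κ * x) := by
      rcases hx.eq_or_lt with rfl | hx
      · simp
      · linarith [key x₁ x le_rfl hx]
    calc f x = Real.exp (Real.log (f x)) := (Real.exp_log p).symm
      _ ≤ Real.exp (Real.log (f x₁) + (κ * x₁ + -κ * x)) := Real.exp_le_exp.2 this
      _ = _ := by rw [Real.exp_add, Real.exp_log p1]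

/-- The exponential tail supplies the finite second moment that makes both equilibrium costs finite.
-/
lemma integrable_sq_mul (hf : IsLogConcaveDensity f) (hL : tsupport f = Ici L) :
    Integrable (fun x => x ^ 2 * f x) := by
  obtain ⟨X, hX, -, κ, hκ, C, hC⟩ := hf.exists_tail hL
  have hm : Measurable (fun x => x ^ 2 * f x) := (measurable_id.pow_const 2).mul hf.measurable
  have h1 : IntegrableOn (fun x => x ^ 2 * f x) (Iic X) := by
    refine Integrable.mono' (g := fun x => (L ^ 2 + X ^ 2) * f x)
      (hf.integrable.const_mul _).integrableOn hm.aestronglyMeasurable.restrict ?_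
    refine (ae_restrict_iff' measurableSet_Iic).2 (Filter.Eventually.of_forall fun x hx => ?_)
    have h0 := hf.nonneg x
    rw [Real.norm_of_nonneg (by positivity)]
    rcases lt_or_ge x L with hxL | hxL
    · simp [eq_zero_of_lt hL hxL]
    · refine mul_le_mul_of_nonneg_right ?_ h0
      rcases le_total 0 x with hx0 | hx0
      · nlinarith [mem_Iic.1 hx, sq_nonneg L]
      · nlinarith [mem_Iic.1 hx, sq_nonneg X]
  have h2 : IntegrableOn (fun x => x ^ 2 * f x) (Ioi X) := by
    -- From `z ^ 2 / 2 ≤ exp |z|` at `z = κ / 2 * x`; half the decay rate is spent on the square and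
    -- half remains.
    have hpow : ∀ x : ℝ, x ^ 2 ≤ (8 / κ ^ 2) * (Real.exp (κ / 2 * x) + Real.exp (-(κ / 2) * x)) := by
      intro x
      have ha : (κ / 2 * x) ^ 2 / 2 ≤ Real.exp (|κ / 2 * x|) := by
        have := Real.pow_div_factorial_le_exp (|κ / 2 * x|) (abs_nonneg _) 2
        rwa [sq_abs, Nat.factorial_two, Nat.cast_ofNat] at this
      have hb : Real.exp (|κ / 2 * x|) ≤ Real.exp (κ / 2 * x) + Real.exp (-(κ / 2) * x) := by
        rcases abs_cases (κ / 2 * x) with h | h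
        · rw [h.1]; linarith [Real.exp_pos (-(κ / 2) * x)]
        · rw [h.1, neg_mul]; linarith [Real.exp_pos (κ / 2 * x)]
      rw [div_mul_eq_mul_div, le_div_iff₀ (by positivity)]
      nlinarith [ha.trans hb]
    have hg : IntegrableOn (fun x => (8 / κ ^ 2 * C) *
        (Real.exp (-(κ / 2) * x) + Real.exp (-(3 * κ / 2) * x))) (Ioi X) :=
      ((integrableOn_exp_mul_Ioi (by linarith) X).add
        (integrableOn_exp_mul_Ioi (by linarith) X)).const_mul _
    refine Integrable.mono' hg hm.aestronglyMeasurable.restrict ?_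
    refine (ae_restrict_iff' measurableSet_Ioi).2 (Filter.Eventually.of_forall fun x hx => ?_)
    have h0 := hf.nonneg x
    rw [Real.norm_of_nonneg (by positivity)]
    calc x ^ 2 * f x ≤ (8 / κ ^ 2) * (Real.exp (κ / 2 * x) + Real.exp (-(κ / 2) * x)) *
          (C * Real.exp (-κ * x)) :=
          mul_le_mul (hpow x) (hC x (le_of_lt hx)) h0 (by positivity)
      _ = (8 / κ ^ 2 * C) * (Real.exp (κ / 2 * x) * Real.exp (-κ * x) +
          Real.exp (-(κ / 2) * x) * Real.exp (-κ * x)) := by ring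
      _ = _ := by rw [← Real.exp_add, ← Real.exp_add]; congr 3 <;> ring_nf
  have := h1.union h2
  rwa [Iic_union_Ioi, integrableOn_univ] at this

lemma integrable_mul (hf : IsLogConcaveDensity f) (hL : tsupport f = Ici L) :
    Integrable (fun x => x * f x) := by
  refine Integrable.mono' (g := fun x => f x + x ^ 2 * f x)
    (hf.integrable.add (hf.integrable_sq_mul hL))
    (measurable_id.mul hf.measurable).aestronglyMeasurable (Filter.Eventually.of_forall fun x => ?_)
  rw [norm_mul, Real.norm_of_nonneg (hf.nonneg x), Real.norm_eq_abs]
  have : |x| ≤ 1 + x ^ 2 := by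
    rw [← sq_abs]
    nlinarith [sq_nonneg (|x| - 1), abs_nonneg x]
  nlinarith [mul_le_mul_of_nonneg_right this (hf.nonneg x)]

end IsLogConcaveDensity

/-! ### Centroids of intervals. -/

/-- The centroid of the set `E` with respect to the density `f`. -/
noncomputable def centroid (f : ℝ → ℝ) (E : Set ℝ) : ℝ :=
  (∫ t in E, t * f t) / ∫ t in E, f t

namespace IsLogConcaveDensity

variable {f : ℝ → ℝ} {L : ℝ} {E D : Set ℝ}

lemma setIntegral_pos (hf : IsLogConcaveDensity f) (hL : tsupport f = Ici L)
    (hEL : E ⊆ Ici L) (hv : volume E ≠ 0) : 0 < ∫ t in E, f t := by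
  rw [setIntegral_pos_iff_support_of_nonneg_ae (Filter.Eventually.of_forall hf.nonneg)
    hf.integrable.integrableOn]
  refine (pos_iff_ne_zero.2 hv).trans_le ?_
  have : E ⊆ (Function.support f ∩ E) ∪ {L} := fun x hx => by
    rcases (mem_Ici.1 (hEL hx)).eq_or_lt with h | h
    · exact Or.inr h.symm
    · exact Or.inl ⟨(hf.pos_of_lt hL h).ne', hx⟩
  refine (measure_mono this).trans ((measure_union_le _ _).trans ?_)
  simp

lemma setIntegral_sub_mul (hf : IsLogConcaveDensity f) (hL : tsupport f = Ici L) (v : ℝ) :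
    ∫ t in E, (t - v) * f t = (∫ t in E, t * f t) - v * ∫ t in E, f t := by
  simp_rw [sub_mul]
  rw [integral_sub (hf.integrable_mul hL).integrableOn
    (hf.integrable.const_mul v).integrableOn, integral_const_mul]

lemma integrable_sub_mul (hf : IsLogConcaveDensity f) (hL : tsupport f = Ici L) (v : ℝ) :
    Integrable (fun t => (t - v) * f t) := by
  simp_rw [sub_mul]
  exact (hf.integrable_mul hL).sub (hf.integrable.const_mul v)

lemma centroid_lt_iff (hf : IsLogConcaveDensity f) (hL : tsupport f = Ici L)
    (hE : 0 < ∫ t in E, f t) {v : ℝ} : centroid f E < v ↔ ∫ t in E, (t - v) * f t < 0 := by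
  rw [hf.setIntegral_sub_mul hL, centroid, div_lt_iff₀ hE, sub_neg]

lemma centroid_le_iff (hf : IsLogConcaveDensity f) (hL : tsupport f = Ici L)
    (hE : 0 < ∫ t in E, f t) {v : ℝ} : centroid f E ≤ v ↔ ∫ t in E, (t - v) * f t ≤ 0 := by
  rw [hf.setIntegral_sub_mul hL, centroid, div_le_iff₀ hE, sub_nonpos]

lemma lt_centroid_iff (hf : IsLogConcaveDensity f) (hL : tsupport f = Ici L)
    (hE : 0 < ∫ t in E, f t) {v : ℝ} : v < centroid f E ↔ 0 < ∫ t in E, (t - v) * f t := by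
  rw [hf.setIntegral_sub_mul hL, centroid, lt_div_iff₀ hE, sub_pos]

lemma centroid_eq_iff (hf : IsLogConcaveDensity f) (hL : tsupport f = Ici L)
    (hE : 0 < ∫ t in E, f t) {v : ℝ} : centroid f E = v ↔ ∫ t in E, (t - v) * f t = 0 := by
  rw [hf.setIntegral_sub_mul hL, centroid, div_eq_iff hE.ne', sub_eq_zero]

lemma integral_centroid (hf : IsLogConcaveDensity f) (hL : tsupport f = Ici L)
    (hE : 0 < ∫ t in E, f t) : ∫ t in E, (t - centroid f E) * f t = 0 :=
  (hf.centroid_eq_iff hL hE).1 rfl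

/-- A non-null set to the right of `a` has its centroid to the right of `a`. -/
lemma lt_centroid (hf : IsLogConcaveDensity f) (hL : tsupport f = Ici L)
    (hE : MeasurableSet E) (hEL : E ⊆ Ici L) (hv : volume E ≠ 0) {a : ℝ} (ha : ∀ t ∈ E, a < t) :
    a < centroid f E := by
  rw [hf.lt_centroid_iff hL (hf.setIntegral_pos hL hEL hv)]
  rw [setIntegral_pos_iff_support_of_nonneg_ae ((ae_restrict_iff' hE).2
    (Filter.Eventually.of_forall fun t ht => mul_nonneg (sub_nonneg.2 (ha t ht).le) (hf.nonneg t)))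
    (hf.integrable_sub_mul hL a).integrableOn]
  refine (pos_iff_ne_zero.2 hv).trans_le ?_
  have : E ⊆ (Function.support (fun t => (t - a) * f t) ∩ E) ∪ {L} := fun x hx => by
    rcases (mem_Ici.1 (hEL hx)).eq_or_lt with h | h
    · exact Or.inr h.symm
    · exact Or.inl ⟨(mul_pos (sub_pos.2 (ha x hx)) (hf.pos_of_lt hL h)).ne', hx⟩
  refine (measure_mono this).trans ((measure_union_le _ _).trans ?_)
  simp

lemma centroid_lt (hf : IsLogConcaveDensity f) (hL : tsupport f = Ici L)
    (hE : MeasurableSet E) (hEL : E ⊆ Ici L) (hv : volume E ≠ 0) {a : ℝ} (ha : ∀ t ∈ E, t < a) :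
    centroid f E < a := by
  rw [hf.centroid_lt_iff hL (hf.setIntegral_pos hL hEL hv), ← neg_pos, ← integral_neg]
  rw [setIntegral_pos_iff_support_of_nonneg_ae ((ae_restrict_iff' hE).2
    (Filter.Eventually.of_forall fun t ht => by
      have := mul_nonneg (sub_nonneg.2 (ha t ht).le) (hf.nonneg t)
      simp only [Pi.zero_apply]; linarith))
    (Integrable.integrableOn (f := fun t => -((t - a) * f t)) (hf.integrable_sub_mul hL a).neg)]
  refine (pos_iff_ne_zero.2 hv).trans_le ?_
  have : E ⊆ (Function.support (fun t => -((t - a) * f t)) ∩ E) ∪ {L} := fun x hx => by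
    rcases (mem_Ici.1 (hEL hx)).eq_or_lt with h | h
    · exact Or.inr h.symm
    · exact Or.inl ⟨neg_ne_zero.2 (mul_ne_zero (sub_neg.2 (ha x hx)).ne (hf.pos_of_lt hL h).ne'), hx⟩
  refine (measure_mono this).trans ((measure_union_le _ _).trans ?_)
  simp

/-- The first moment about a set's own centroid vanishes, so over the union only the other set
contributes, and its sign is known because the sets are separated by `a`. -/
lemma centroid_lt_union (hf : IsLogConcaveDensity f) (hL : tsupport f = Ici L)
    (hE : MeasurableSet E) (hEL : E ⊆ Ici L) (hEv : volume E ≠ 0)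
    (hD : MeasurableSet D) (hDL : D ⊆ Ici L) (hDv : volume D ≠ 0)
    {a : ℝ} (hEa : ∀ t ∈ E, t < a) (hDa : ∀ t ∈ D, a < t) :
    centroid f E < centroid f (E ∪ D) ∧ centroid f (E ∪ D) < centroid f D := by
  have hdisj : Disjoint E D := Set.disjoint_left.2 fun t h1 h2 => (hEa t h1).not_gt (hDa t h2)
  have h1 := hf.setIntegral_pos hL hEL hEv
  have h2 := hf.setIntegral_pos hL hDL hDv
  have h3 : centroid f E < centroid f D :=
    (hf.centroid_lt hL hE hEL hEv hEa).trans (hf.lt_centroid hL hD hDL hDv hDa)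
  have h4 := hf.setIntegral_pos hL (union_subset hEL hDL)
    (fun h => hEv (measure_mono_null subset_union_left h))
  rw [hf.lt_centroid_iff hL h4, hf.centroid_lt_iff hL h4]
  rw [setIntegral_union hdisj hD (hf.integrable_sub_mul hL _).integrableOn
    (hf.integrable_sub_mul hL _).integrableOn,
    setIntegral_union hdisj hD (hf.integrable_sub_mul hL _).integrableOn
    (hf.integrable_sub_mul hL _).integrableOn, hf.integral_centroid hL h1,
    hf.integral_centroid hL h2, zero_add, add_zero]
  exact ⟨(hf.lt_centroid_iff hL h2).1 h3, (hf.centroid_lt_iff hL h1).1 h3⟩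

/-- Translating back by `s` turns the density into `f (t + s)`, whose ratio to `f t` is
nonincreasing. This shifts weight to the left, so the mean cannot rise above that of `f`. -/
lemma centroid_shift_le (hf : IsLogConcaveDensity f) (hL : tsupport f = Ici L)
    (hE : MeasurableSet E) (hEL : E ⊆ Ioi L) (hv : volume E ≠ 0) {s : ℝ} (hs : 0 ≤ s) :
    centroid f ((fun t => t - s) ⁻¹' E) ≤ centroid f E + s := by
  have hE0 := hf.setIntegral_pos hL (hEL.trans Ioi_subset_Ici_self) hv
  have hmp : MeasurePreserving (fun t : ℝ => t - s) := measurePreserving_sub_right volume s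
  have hme : MeasurableEmbedding (fun t : ℝ => t - s) := (MeasurableEquiv.subRight s).measurableEmbedding
  have hE' : MeasurableSet ((fun t => t - s) ⁻¹' E) := hme.measurable hE
  have hEs : 0 < ∫ t in (fun t => t - s) ⁻¹' E, f t := by
    refine hf.setIntegral_pos hL (fun t ht => ?_) (by rwa [hmp.measure_preimage hE.nullMeasurableSet])
    have := hEL ht
    simp only [mem_Ioi, mem_Ici] at this ⊢
    linarith
  rw [hf.centroid_le_iff hL hEs]
  set μ := centroid f E with hμ
  have hμL : L < μ := hf.lt_centroid hL hE (hEL.trans Ioi_subset_Ici_self) hv fun t ht => hEL ht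
  have hfμ := hf.pos_of_lt hL hμL
  have h1 : ∫ t in (fun t => t - s) ⁻¹' E, (t - (μ + s)) * f t = ∫ t in E, (t - μ) * f (t + s) := by
    rw [← hmp.setIntegral_preimage_emb hme (fun t => (t - μ) * f (t + s))]
    refine integral_congr_ae (Filter.Eventually.of_forall fun t => ?_)
    simp only [sub_add_cancel]
    ring_nf
  rw [h1]
  have hint : Integrable (fun t => (t - μ) * f (t + s)) := by
    have := (hf.integrable_sub_mul hL (μ + s)).comp_add_right s
    refine this.congr (Filter.Eventually.of_forall fun t => ?_)
    simp only []
    ring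
  -- Comparing the ratio at `t` with the ratio at `μ` gives the pointwise inequality on both sides
  -- of `μ`; the right-hand integral vanishes because `μ` is the centroid.
  have h2 : ∫ t in E, f μ * ((t - μ) * f (t + s)) ≤ ∫ t in E, f (μ + s) * ((t - μ) * f t) := by
    refine setIntegral_mono_on (hint.const_mul _).integrableOn
      ((hf.integrable_sub_mul hL μ).const_mul _).integrableOn hE fun t ht => ?_
    rcases le_total μ t with h | h
    · nlinarith [mul_le_mul_of_nonneg_left (hf.mul_shift_le hL hμL h hs) (sub_nonneg.2 h)]
    · nlinarith [mul_le_mul_of_nonneg_left (hf.mul_shift_le hL (hEL ht) h hs) (sub_nonneg.2 h)]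
  rw [integral_const_mul, integral_const_mul, hf.integral_centroid hL hE0, mul_zero] at h2
  exact nonpos_of_mul_nonpos_right h2 hfμ

lemma centroid_congr (h : E =ᵐ[volume] D) : centroid f E = centroid f D := by
  simp only [centroid, setIntegral_congr_set h]

lemma centroid_le_midpoint (hf : IsLogConcaveDensity f) (hL : tsupport f = Ici L) {X x y : ℝ}
    (hX : AntitoneOn f (Ici X)) (hLX : L ≤ X) (hx : X ≤ x) (hxy : x < y) :
    centroid f (Ioo x y) ≤ (x + y) / 2 := by
  have h0 : 0 < ∫ t in Ioo x y, f t := hf.setIntegral_pos hL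
    (fun t ht => by simp only [mem_Ici]; linarith [ht.1]) (by simpa using hxy)
  rw [hf.centroid_le_iff hL h0]
  -- Replacing `f t` by its midpoint value lowers the density left of the midpoint and raises it on
  -- the right.
  have h1 : ∫ t in Ioo x y, (t - (x + y) / 2) * f t ≤
      ∫ t in Ioo x y, (t - (x + y) / 2) * f ((x + y) / 2) := by
    refine setIntegral_mono_on (hf.integrable_sub_mul hL _).integrableOn
      ((Continuous.integrableOn_Icc (by fun_prop)).mono_set Ioo_subset_Icc_self)
      measurableSet_Ioo fun t ht => ?_
    have hm : X ≤ (x + y) / 2 := by linarith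
    have ht' : X ≤ t := hx.trans ht.1.le
    rcases le_total t ((x + y) / 2) with h | h
    · nlinarith [hX ht' hm h]
    · nlinarith [hX hm ht' h]
  refine h1.trans_eq ?_
  rw [integral_mul_const, ← integral_Ioc_eq_integral_Ioo, ← intervalIntegral.integral_of_le hxy.le]
  rw [intervalIntegral.integral_sub (by simp) (by simp), integral_id,
    intervalIntegral.integral_const, smul_eq_mul]
  ring

lemma Ioo_union_ae {x y : ℝ} {A : Set ℝ} (h : Ioo x y ∪ A ∪ {y} = D) :
    (Ioo x y ∪ A : Set ℝ) =ᵐ[volume] D := by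
  rw [← h]
  exact (union_ae_eq_left_of_ae_eq_empty (by simp)).symm

lemma centroidSystem (hf : IsLogConcaveDensity f) (hL : tsupport f = Ici L) :
    CentroidSystem L (fun x y => centroid f (Ioo x y)) (fun x => centroid f (Ioi x) - x) := by
  have sub : ∀ {x y}, L ≤ x → Ioo x y ⊆ Ici L := fun hx t ht => hx.trans ht.1.le
  have sub' : ∀ {x}, L ≤ x → Ioi x ⊆ Ici L := fun hx t ht => hx.trans (le_of_lt ht)
  have hv : ∀ {x y : ℝ}, x < y → volume (Ioo x y) ≠ 0 := fun h => by simpa using h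
  have hv' : ∀ {x : ℝ}, volume (Ioi x) ≠ 0 := by simp
  have split : ∀ {x y z : ℝ}, x < y → y < z → centroid f (Ioo x z) = centroid f (Ioo x y ∪ Ioo y z) :=
    fun {x y z} h h' => (centroid_congr (Ioo_union_ae (by
      ext t; simp only [mem_union, mem_Ioo, mem_singleton_iff]; grind))).symm
  have split' : ∀ {x y : ℝ}, x < y → centroid f (Ioi x) = centroid f (Ioo x y ∪ Ioi y) :=
    fun {x y} h => (centroid_congr (Ioo_union_ae (by
      ext t; simp only [mem_union, mem_Ioo, mem_Ioi, mem_singleton_iff]; grind))).symm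
  have mono : ∀ {x y z : ℝ}, L ≤ x → x < y → y < z → centroid f (Ioo x y) < centroid f (Ioo x z) ∧
      centroid f (Ioo x z) < centroid f (Ioo y z) := fun hx h h' => by
    rw [split h h']
    exact hf.centroid_lt_union hL measurableSet_Ioo (sub hx) (hv h) measurableSet_Ioo
      (sub (hx.trans h.le)) (hv h') (fun t ht => ht.2) fun t ht => ht.1
  have mono' : ∀ {x y : ℝ}, L ≤ x → x < y → centroid f (Ioo x y) < centroid f (Ioi x) ∧
      centroid f (Ioi x) < centroid f (Ioi y) := fun hx h => by
    rw [split' h]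
    exact hf.centroid_lt_union hL measurableSet_Ioo (sub hx) (hv h) measurableSet_Ioi
      (sub' (hx.trans h.le)) hv' (fun t ht => ht.2) fun t ht => ht
  refine ⟨fun hx h => hf.lt_centroid hL measurableSet_Ioo (sub hx) (hv h) fun t ht => ht.1,
    fun hx h => hf.centroid_lt hL measurableSet_Ioo (sub hx) (hv h) fun t ht => ht.2,
    fun hx h h' => (mono hx h h').2, fun hx h h' => (mono hx h h').1, ?_, ?_, ?_, ?_, ?_⟩
  · intro x y s hx h hs
    have := hf.centroid_shift_le hL measurableSet_Ioo (fun t ht => hx.trans_lt ht.1) (hv h) hs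
    rwa [preimage_sub_const_Ioo] at this
  · exact fun hx => sub_pos.2 <| hf.lt_centroid hL measurableSet_Ioi (sub' hx) hv' fun t ht => ht
  · exact fun hx h => by linarith [(mono' hx h).1]
  · intro x x' hx h
    have := hf.centroid_shift_le hL measurableSet_Ioi (fun t ht => hx.trans_lt ht) hv' (sub_nonneg.2 h)
    rw [preimage_sub_const_Ioi, add_sub_cancel] at this
    linarith
  · intro x x' hx h
    rcases h.eq_or_lt with rfl | h
    · exact le_rfl
    · linarith [(mono' hx h).2]

end IsLogConcaveDensity

/-! ### Correspondence between families of bins and chains. -/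

/-- The edges `m`, starting from `x`, and the actions `u` cut `[x, ∞)` into bins such that each
action is the centroid of its bin and the encoder is indifferent at every interior edge. -/
structure CentroidBins (f : ℝ → ℝ) (b x : ℝ) {n : ℕ} (m : Fin (n + 1 + 1) → EReal)
    (u : Fin (n + 1) → ℝ) : Prop where
  first : m 0 = x
  last : m (Fin.last (n + 1)) = ⊤
  strictMono : StrictMono m
  eq_centroid : ∀ k, u k = centroid f (bin m k)
  indifferent : ∀ i : Fin n, m i.succ.castSucc = (((u i.castSucc + u i.succ) / 2 + b : ℝ) : EReal)

lemma bin_eq_Ico {N : ℕ} {m : Fin (N + 1) → EReal} {k : Fin N} {x y : ℝ} (hx : m k.castSucc = x)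
    (hy : m k.succ = y) : bin m k = Ico x y := by
  ext t
  simp [bin, hx, hy]

lemma bin_eq_Ici {N : ℕ} {m : Fin (N + 1) → EReal} {k : Fin N} {x : ℝ} (hx : m k.castSucc = x)
    (hy : m k.succ = ⊤) : bin m k = Ici x := by
  ext t
  simp [bin, hx, hy]

lemma measurableSet_bin {N : ℕ} (m : Fin (N + 1) → EReal) (k : Fin N) : MeasurableSet (bin m k) :=
  (measurableSet_le measurable_const measurable_coe_real_ereal).inter
    (measurableSet_lt measurable_coe_real_ereal measurable_const)

lemma bin_injective {N : ℕ} {m : Fin (N + 1) → EReal} (hm : StrictMono m) {j k : Fin N} {x : ℝ}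
    (hj : x ∈ bin m j) (hk : x ∈ bin m k) : j = k := by
  by_contra h
  rcases lt_or_gt_of_ne h with h | h
  · exact absurd (hj.2.trans_le ((hm.monotone (Fin.succ_le_castSucc_iff.2 h)).trans hk.1))
      (lt_irrefl _)
  · exact absurd (hk.2.trans_le ((hm.monotone (Fin.succ_le_castSucc_iff.2 h)).trans hj.1))
      (lt_irrefl _)

lemma exists_mem_bin {N : ℕ} {m : Fin (N + 1) → EReal} {L x : ℝ} (h0 : m 0 = L)
    (hlast : m (Fin.last N) = ⊤) (hx : L ≤ x) : ∃ k, x ∈ bin m k := by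
  classical
  let s : Finset (Fin (N + 1)) := Finset.univ.filter fun i => m i ≤ x
  have hs : s.Nonempty := ⟨0, by simp [s, h0, hx]⟩
  have hmem := s.max'_mem hs
  obtain ⟨i, hi⟩ : ∃ i, i = s.max' hs := ⟨_, rfl⟩
  rw [← hi] at hmem
  have hle : m i ≤ x := by simpa [s] using hmem
  induction i using Fin.lastCases with
  | last => rw [hlast] at hle; exact absurd hle (by simp)
  | cast k =>
    refine ⟨k, hle, ?_⟩
    by_contra! h
    have := s.le_max' k.succ (by simpa [s] using h)
    rw [← hi] at this
    exact absurd (Fin.castSucc_lt_succ (i := k)) (not_lt.2 this)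

lemma edge_real {N : ℕ} {m : Fin (N + 1) → EReal} {L : ℝ} (h0 : m 0 = L) (hm : StrictMono m)
    (k : Fin N) : ∃ a : ℝ, L ≤ a ∧ m k.castSucc = a := by
  have h1 : m k.castSucc ≠ ⊤ := (hm (Fin.castSucc_lt_last k)).ne_top
  have h2 : (L : EReal) ≤ m k.castSucc := h0 ▸ hm.monotone (Fin.zero_le _)
  have h3 : m k.castSucc ≠ ⊥ := ne_bot_of_le_ne_bot (EReal.coe_ne_bot L) h2
  refine ⟨(m k.castSucc).toReal, ?_, (EReal.coe_toReal h1 h3).symm⟩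
  rw [← EReal.coe_le_coe_iff, EReal.coe_toReal h1 h3]
  exact h2

lemma exists_Ioo_subset_bin {N : ℕ} {m : Fin (N + 1) → EReal} (hm : StrictMono m)
    {k : Fin N} {a : ℝ} (ha : m k.castSucc = a) : ∃ z : ℝ, a < z ∧ Ioo a z ⊆ bin m k := by
  obtain ⟨z, hz, hz'⟩ := EReal.lt_iff_exists_real_btwn.1 (hm (Fin.castSucc_lt_succ (i := k)))
  rw [ha, EReal.coe_lt_coe_iff] at hz
  refine ⟨z, hz, fun t ht => ⟨?_, ?_⟩⟩
  · rw [ha]; exact_mod_cast ht.1.le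
  · exact lt_trans (by exact_mod_cast ht.2) hz'

lemma bin_subset_Ici {N : ℕ} {m : Fin (N + 1) → EReal} {L : ℝ} (h0 : m 0 = L) (hm : StrictMono m)
    (k : Fin N) : bin m k ⊆ Ici L := by
  obtain ⟨a, hLa, ha⟩ := edge_real h0 hm k
  intro t ht
  have := ht.1
  rw [ha, EReal.coe_le_coe_iff] at this
  exact hLa.trans this

lemma volume_bin_ne_zero {N : ℕ} {m : Fin (N + 1) → EReal} {L : ℝ} (h0 : m 0 = L)
    (hm : StrictMono m) (k : Fin N) : volume (bin m k) ≠ 0 := by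
  obtain ⟨a, -, ha⟩ := edge_real h0 hm k
  obtain ⟨z, hz, hsub⟩ := exists_Ioo_subset_bin hm ha
  exact fun h => absurd (measure_mono_null hsub h) (by simpa using hz)

namespace CentroidBins

variable {f : ℝ → ℝ} {L b : ℝ}

lemma centroid_Ico (x y : ℝ) : centroid f (Ico x y) = centroid f (Ioo x y) :=
  IsLogConcaveDensity.centroid_congr Ioo_ae_eq_Ico.symm

lemma centroid_Ici (x : ℝ) : centroid f (Ici x) = centroid f (Ioi x) :=
  IsLogConcaveDensity.centroid_congr Ioi_ae_eq_Ici.symm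

lemma tail {n : ℕ} {x : ℝ} {m : Fin (n + 1 + 1 + 1) → EReal} {u : Fin (n + 1 + 1) → ℝ}
    (h : CentroidBins f b x m u) :
    ∃ y, x < y ∧ CentroidBins f b y (Fin.tail m) (Fin.tail u) ∧ u 0 = centroid f (Ioo x y) ∧
      y - centroid f (Ioo x y) = (Fin.tail u 0 - y) + 2 * b := by
  have hm1 := h.indifferent 0
  set y := (u (Fin.castSucc 0) + u (Fin.succ 0)) / 2 + b with hy
  have hxy : x < y := by
    have := h.strictMono (show (0 : Fin (n + 1 + 1 + 1)) < (Fin.succ 0).castSucc from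
      Fin.succ_pos (Fin.castSucc 0))
    rwa [h.first, hm1, EReal.coe_lt_coe_iff] at this
  have hu : u 0 = centroid f (Ioo x y) := by
    rw [h.eq_centroid 0, bin_eq_Ico (x := x) (y := y) h.first hm1, centroid_Ico]
  refine ⟨y, hxy, ⟨hm1, h.last, fun i j hij => h.strictMono (Fin.succ_lt_succ_iff.2 hij),
    fun k => h.eq_centroid k.succ, fun i => h.indifferent i.succ⟩, hu, ?_⟩
  rw [← hu]
  have : Fin.tail u 0 = u (Fin.succ 0) := rfl
  rw [this, hy, Fin.castSucc_zero]
  ring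

lemma zero_eq {x : ℝ} {m : Fin (0 + 1 + 1) → EReal} {u : Fin (0 + 1) → ℝ}
    (h : CentroidBins f b x m u) : u 0 = centroid f (Ioi x) := by
  rw [h.eq_centroid 0, bin_eq_Ici (x := x) h.first h.last, centroid_Ici]

lemma cons {n : ℕ} {x y : ℝ} {m : Fin (n + 1 + 1) → EReal} {u : Fin (n + 1) → ℝ}
    (h : CentroidBins f b y m u) (hxy : x < y)
    (he : y - centroid f (Ioo x y) = (u 0 - y) + 2 * b) :
    CentroidBins f b x (n := n + 1) (Fin.cons (x : EReal) m)
      (Fin.cons (centroid f (Ioo x y)) u) := by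
  refine ⟨rfl, h.last, ?_, fun k => ?_, fun i => ?_⟩
  · rw [Fin.strictMono_iff_lt_succ]
    intro i
    refine Fin.cases ?_ (fun i => ?_) i
    · simp only [Fin.castSucc_zero, Fin.cons_zero, Fin.cons_succ]
      rw [h.first, EReal.coe_lt_coe_iff]
      exact hxy
    · exact h.strictMono (Fin.castSucc_lt_succ (i := i))
  · refine Fin.cases ?_ (fun k => ?_) k
    · rw [bin_eq_Ico (x := x) (y := y) rfl h.first, centroid_Ico, Fin.cons_zero]
    · exact h.eq_centroid k
  · refine Fin.cases ?_ (fun i => ?_) i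
    · change m 0 = _
      rw [h.first, EReal.coe_eq_coe_iff]
      change y = (centroid f (Ioo x y) + u 0) / 2 + b
      linarith
    · exact h.indifferent i

lemma single (x : ℝ) : CentroidBins f b x (n := 0) ![(x : EReal), ⊤] ![centroid f (Ioi x)] := by
  refine ⟨rfl, rfl, ?_, fun k => ?_, fun i => i.elim0⟩
  · rw [Fin.strictMono_iff_lt_succ]
    intro i
    fin_cases i
    simp
  · fin_cases k
    rw [bin_eq_Ici (x := x) rfl rfl, centroid_Ici]
    rfl

lemma binChain {n : ℕ} : ∀ {x : ℝ} {m : Fin (n + 1 + 1) → EReal} {u : Fin (n + 1) → ℝ},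
    CentroidBins f b x m u →
    BinChain b (fun x y => centroid f (Ioo x y)) (fun x => centroid f (Ioi x) - x) n x
      (u 0 - x) := by
  induction n with
  | zero =>
    intro x m u h
    rw [h.zero_eq]
    exact BinChain.last x
  | succ n ih =>
    intro x m u h
    obtain ⟨y, hxy, ht, hu, he⟩ := h.tail
    rw [hu]
    exact BinChain.cons hxy (ih ht) he

lemma exists_of_binChain {n : ℕ} : ∀ {x e : ℝ},
    BinChain b (fun x y => centroid f (Ioo x y)) (fun x => centroid f (Ioi x) - x) n x e →
    ∃ (m : Fin (n + 1 + 1) → EReal) (u : Fin (n + 1) → ℝ),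
      CentroidBins f b x m u ∧ u 0 - x = e := by
  induction n with
  | zero =>
    intro x e h
    cases h
    exact ⟨_, _, single x, rfl⟩
  | succ n ih =>
    intro x e h
    cases h with
    | @cons _ _ y e hxy h he =>
    obtain ⟨m, u, hmu, rfl⟩ := ih h
    exact ⟨_, _, hmu.cons hxy he, rfl⟩

/-- Both families have tails that are chains, so `BinChain.edge_eq` makes their first interior edges
coincide, and the induction applies beyond it. -/
lemma unique (hf : IsLogConcaveDensity f) (hL : tsupport f = Ici L) {n : ℕ} :
    ∀ {x : ℝ} {m m' : Fin (n + 1 + 1) → EReal} {u u' : Fin (n + 1) → ℝ}, L ≤ x →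
    CentroidBins f b x m u → CentroidBins f b x m' u' → m = m' ∧ u = u' := by
  induction n with
  | zero =>
    intro x m m' u u' _ h h'
    constructor
    · ext i
      refine Fin.cases ?_ (fun i => ?_) i
      · rw [h.first, h'.first]
      · fin_cases i
        exact h.last.trans h'.last.symm
    · ext i
      fin_cases i
      exact h.zero_eq.trans h'.zero_eq.symm
  | succ n ih =>
    intro x m m' u u' hx h h'
    obtain ⟨y, hxy, ht, hu, he⟩ := h.tail
    obtain ⟨y', hxy', ht', hu', he'⟩ := h'.tail
    obtain rfl : y = y' := BinChain.edge_eq (hf.centroidSystem hL) hx hxy hxy'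
      ht.binChain ht'.binChain he he'
    obtain ⟨h1, h2⟩ := ih (by linarith) ht ht'
    constructor
    · rw [← Fin.cons_self_tail m, ← Fin.cons_self_tail m', h1, h.first, h'.first]
    · rw [← Fin.cons_self_tail u, ← Fin.cons_self_tail u', h2, hu, hu']

lemma action_lt_edge (hf : IsLogConcaveDensity f) (hL : tsupport f = Ici L) {n : ℕ}
    {m : Fin (n + 1 + 1) → EReal} {u : Fin (n + 1) → ℝ} (h : CentroidBins f b L m u)
    {k : Fin (n + 1)} {a : ℝ} (ha : m k.succ = a) : u k < a := by
  rw [h.eq_centroid k]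
  refine hf.centroid_lt hL (measurableSet_bin m k) (bin_subset_Ici h.first h.strictMono k)
    (volume_bin_ne_zero h.first h.strictMono k) fun t ht => ?_
  have := ht.2
  rwa [ha, EReal.coe_lt_coe_iff] at this

lemma edge_lt_action (hf : IsLogConcaveDensity f) (hL : tsupport f = Ici L) {n : ℕ}
    {m : Fin (n + 1 + 1) → EReal} {u : Fin (n + 1) → ℝ} (h : CentroidBins f b L m u)
    {k : Fin (n + 1)} {a : ℝ} (ha : m k.castSucc = a) : a < u k := by
  obtain ⟨a', hLa, ha'⟩ := edge_real h.first h.strictMono k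
  obtain rfl : a' = a := by rw [ha] at ha'; exact_mod_cast ha'.symm
  -- The bin contains its left edge; removing this null point gives the strict pointwise inequality
  -- that `lt_centroid` asks for.
  have : ((bin m k \ {a'} : Set ℝ)) =ᵐ[volume] bin m k := sdiff_null_ae_eq_self (by simp)
  rw [h.eq_centroid k, ← IsLogConcaveDensity.centroid_congr this]
  refine hf.lt_centroid hL ((measurableSet_bin m k).diff (measurableSet_singleton a'))
    (sdiff_subset.trans (bin_subset_Ici h.first h.strictMono k)) ?_ fun t ht => ?_
  · rw [measure_congr this]
    exact volume_bin_ne_zero h.first h.strictMono k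
  · have h1 := ht.1.1
    rw [ha, EReal.coe_le_coe_iff] at h1
    exact lt_of_le_of_ne h1 fun h => ht.2 h.symm

lemma action_strictMono (hf : IsLogConcaveDensity f) (hL : tsupport f = Ici L) {n : ℕ}
    {m : Fin (n + 1 + 1) → EReal} {u : Fin (n + 1) → ℝ} (h : CentroidBins f b L m u) :
    StrictMono u := by
  rw [Fin.strictMono_iff_lt_succ]
  intro i
  exact (h.action_lt_edge hf hL (k := i.castSucc) (h.indifferent i)).trans
    (h.edge_lt_action hf hL (h.indifferent i))

end CentroidBins

/-! ### The law of the source. -/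

namespace IsLogConcaveDensity

variable {f : ℝ → ℝ} {L : ℝ} {E : Set ℝ}

lemma isProbabilityMeasure (hf : IsLogConcaveDensity f) : IsProbabilityMeasure (sourceLaw f) :=
  ⟨by rw [sourceLaw, withDensity_apply _ MeasurableSet.univ, setLIntegral_univ, hf.total_mass]⟩

lemma sourceLaw_absolutelyContinuous (f : ℝ → ℝ) : sourceLaw f ≪ volume :=
  withDensity_absolutelyContinuous _ _

lemma ae_ne (f : ℝ → ℝ) (c : ℝ) : ∀ᵐ x ∂sourceLaw f, x ≠ c := by
  have : ∀ᵐ x : ℝ, x ≠ c := by simp [ae_iff]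
  exact (sourceLaw_absolutelyContinuous f).ae_le this

lemma sourceLaw_ne_zero (hf : IsLogConcaveDensity f) (hL : tsupport f = Ici L)
    (hEL : E ⊆ Ici L) (hv : volume E ≠ 0) : sourceLaw f E ≠ 0 := by
  rw [sourceLaw, Ne, withDensity_apply_eq_zero hf.measurable.ennreal_ofReal]
  refine fun h0 => hv ?_
  have : E ⊆ ({x | ENNReal.ofReal (f x) ≠ 0} ∩ E) ∪ {L} := fun x hx => by
    rcases (mem_Ici.1 (hEL hx)).eq_or_lt with h | h
    · exact Or.inr h.symm
    · exact Or.inl ⟨by simpa using hf.pos_of_lt hL h, hx⟩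
  refine measure_mono_null this (measure_union_null h0 (by simp))

lemma ae_gt (hf : IsLogConcaveDensity f) (hL : tsupport f = Ici L) :
    ∀ᵐ x ∂sourceLaw f, L < x := by
  rw [sourceLaw, ae_withDensity_iff hf.measurable.ennreal_ofReal]
  have : ∀ᵐ x : ℝ, x ≠ L := by simp [ae_iff]
  filter_upwards [this] with x hx h
  rcases lt_trichotomy x L with h' | h' | h'
  · simp [eq_zero_of_lt hL h'] at h
  · exact absurd h' hx
  · exact h'

lemma setIntegral_sourceLaw (hf : IsLogConcaveDensity f) (hE : MeasurableSet E) (g : ℝ → ℝ) :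
    ∫ x in E, g x ∂sourceLaw f = ∫ x in E, g x * f x := by
  rw [sourceLaw, restrict_withDensity hE, integral_withDensity_eq_integral_toReal_smul
    hf.measurable.ennreal_ofReal (by simp)]
  refine integral_congr_ae (Filter.Eventually.of_forall fun x => ?_)
  simp only [smul_eq_mul]
  rw [ENNReal.toReal_ofReal (hf.nonneg x), mul_comm]

lemma integrable_sourceLaw_iff (hf : IsLogConcaveDensity f) {g : ℝ → ℝ} :
    Integrable g (sourceLaw f) ↔ Integrable (fun x => g x * f x) := by
  rw [sourceLaw, integrable_withDensity_iff hf.measurable.ennreal_ofReal (by simp)]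
  simp_rw [ENNReal.toReal_ofReal (hf.nonneg _)]

lemma memLp_id (hf : IsLogConcaveDensity f) (hL : tsupport f = Ici L) :
    MemLp (fun x : ℝ => x) 2 (sourceLaw f) :=
  (memLp_two_iff_integrable_sq measurable_id.aestronglyMeasurable).2
    (hf.integrable_sourceLaw_iff.2 (hf.integrable_sq_mul hL))

/-- A continuous inequality that holds almost surely on an open interval holds on its closure. -/
lemma nonneg_of_ae_Ioo (hf : IsLogConcaveDensity f) (hL : tsupport f = Ici L) {a z : ℝ}
    (ha : L ≤ a) (haz : a < z) {φ : ℝ → ℝ} (hφ : Continuous φ)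
    (h : ∀ᵐ x ∂sourceLaw f, x ∈ Ioo a z → 0 ≤ φ x) : ∀ x ∈ Icc a z, 0 ≤ φ x := by
  have h1 : Ioo a z ⊆ {x | 0 ≤ φ x} := by
    by_contra hne
    obtain ⟨x, hx, hx'⟩ := not_subset.1 hne
    have hopen : IsOpen (Ioo a z ∩ {x | φ x < 0}) := isOpen_Ioo.inter (isOpen_lt hφ continuous_const)
    refine hf.sourceLaw_ne_zero hL (E := Ioo a z ∩ {x | φ x < 0})
      (fun t ht => ha.trans ht.1.1.le)
      (hopen.measure_ne_zero volume ⟨x, hx, by simpa using hx'⟩) (measure_mono_null ?_ h)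
    intro t ht
    simp only [mem_compl_iff, mem_ofPred_eq, Classical.not_imp, not_le]
    exact ht
  have h2 := closure_minimal h1 (isClosed_le continuous_const hφ)
  rwa [closure_Ioo haz.ne] at h2

end IsLogConcaveDensity

/-! ### First-order consequences of the equilibrium conditions. -/

namespace IsNashEquilibrium

variable {P : Measure ℝ} {b : ℝ} {γe γd : ℝ → ℝ}

lemma measurable_action (h : IsNashEquilibrium P b γe γd) : Measurable fun x => γd (γe x) :=
  h.measurable_decoder.comp h.measurable_encoder

lemma lintegral_sq_lt_top {g : ℝ → ℝ} (hg : MemLp g 2 P) :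
    ∫⁻ x, ENNReal.ofReal (g x ^ 2) ∂P < ⊤ := by
  have := hg.integrable_sq.2
  rwa [hasFiniteIntegral_iff_ofReal (Filter.Eventually.of_forall fun x => sq_nonneg _)] at this

lemma memLp_action (h : IsNashEquilibrium P b γe γd) (h2 : MemLp (fun x : ℝ => x) 2 P) :
    MemLp (fun x => x - γd (γe x)) 2 P := by
  have hm : Measurable fun x => x - γd (γe x) := measurable_id.sub h.measurable_action
  rw [memLp_two_iff_integrable_sq hm.aestronglyMeasurable]
  refine ⟨(hm.pow_const 2).aestronglyMeasurable, ?_⟩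
  rw [hasFiniteIntegral_iff_ofReal (Filter.Eventually.of_forall fun x => sq_nonneg _)]
  refine (h.decoder_optimal (fun _ => 0) measurable_const).trans_lt ?_
  simpa [decoderCost] using lintegral_sq_lt_top h2

/-- In equilibrium almost every source value induces an action that is closest to the encoder's
ideal action among all actions available from the decoder. -/
lemma ae_closest [IsFiniteMeasure P] (h : IsNashEquilibrium P b γe γd)
    (h2 : MemLp (fun x : ℝ => x) 2 P) :
    ∀ᵐ x ∂P, ∀ a ∈ range γd, |x - γd (γe x) - b| ≤ |x - a - b| := by
  have hU := h.measurable_action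
  have key : ∀ y, ∀ᵐ x ∂P, |x - γd (γe x) - b| ≤ |x - γd y - b| := by
    intro y
    classical
    set S := {x | |x - γd y - b| < |x - γd (γe x) - b|} with hS
    have hSm : MeasurableSet S := measurableSet_lt
      ((measurable_id.sub_const _).sub_const b).abs ((measurable_id.sub hU).sub_const b).abs
    have hγ : Measurable (S.piecewise (fun _ => y) γe) :=
      Measurable.piecewise hSm measurable_const h.measurable_encoder
    have hle : (fun x => ENNReal.ofReal ((x - γd (S.piecewise (fun _ => y) γe x) - b) ^ 2)) ≤ᵐ[P]
        fun x => ENNReal.ofReal ((x - γd (γe x) - b) ^ 2) := by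
      refine Filter.Eventually.of_forall fun x => ENNReal.ofReal_le_ofReal ?_
      by_cases hx : x ∈ S
      · simp only [hx, piecewise_eq_of_mem]
        exact (sq_lt_sq.2 hx).le
      · simp [hx]
    have hfin : encoderCost P b γe γd < ⊤ := by
      refine (h.encoder_optimal (fun _ => y) measurable_const).trans_lt ?_
      exact lintegral_sq_lt_top ((h2.sub (memLp_const (γd y))).sub (memLp_const b))
    -- The deviation costs no more at any point and no less in total, and the cost is finite; so the
    -- integrands agree almost everywhere and `S` is null.
    have heq := ae_eq_of_ae_le_of_lintegral_le hle
      ((lintegral_mono_ae hle).trans_lt hfin).ne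
      (((measurable_id.sub hU).sub_const b).pow_const 2).ennreal_ofReal.aemeasurable
      (h.encoder_optimal _ hγ)
    filter_upwards [heq] with x hx
    by_contra hlt
    have hxS : x ∈ S := not_le.1 hlt
    rw [piecewise_eq_of_mem _ _ _ hxS, ENNReal.ofReal_eq_ofReal_iff (sq_nonneg _) (sq_nonneg _)] at hx
    exact (sq_lt_sq.2 hxS).ne hx
  -- A dense sequence of available actions allows a single null set; the inequality is closed in `a`
  -- and extends to the rest.
  obtain ⟨s, hs⟩ := TopologicalSpace.exists_dense_seq (range γd)
  have hall : ∀ᵐ x ∂P, ∀ n, |x - γd (γe x) - b| ≤ |x - (s n : ℝ) - b| := by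
    rw [ae_all_iff]
    intro n
    obtain ⟨y, hy⟩ := (s n).2
    rw [← hy]
    exact key y
  filter_upwards [hall] with x hx a ha
  refine hs.induction_on (p := fun a : range γd => |x - γd (γe x) - b| ≤ |x - (a : ℝ) - b|)
    ⟨a, ha⟩ ?_ hx
  exact isClosed_le continuous_const (by fun_prop)

/-- In equilibrium every action is the conditional mean of the source given the action. -/
lemma setIntegral_eq_zero [IsFiniteMeasure P] (h : IsNashEquilibrium P b γe γd)
    (h2 : MemLp (fun x : ℝ => x) 2 P) {B : Set ℝ} (hB : MeasurableSet B) :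
    ∫ x in {x | γd (γe x) ∈ B}, (x - γd (γe x)) ∂P = 0 := by
  classical
  set S := {x | γd (γe x) ∈ B} with hS
  have hU := h.measurable_action
  have hSm : MeasurableSet S := hU hB
  have hL := h.memLp_action h2
  have hint := hL.integrable one_le_two
  set I := ∫ x in S, (x - γd (γe x)) ∂P with hI
  set p := P.real S with hp
  have hp0 : 0 ≤ p := measureReal_nonneg
  -- The decoder deviates by adding `t` to its actions in `B`; expanding the square gives this
  -- condition.
  have key : ∀ t : ℝ, 2 * t * I ≤ t ^ 2 * p := by
    intro t
    have hm : Measurable (fun y => γd y + B.indicator (fun _ => t) (γd y)) :=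
      h.measurable_decoder.add
        ((measurable_const.indicator hB).comp h.measurable_decoder)
    have h3 := h.decoder_optimal _ hm
    have hind : ∀ x, B.indicator (fun _ => t) (γd (γe x)) = S.indicator (fun _ => t) x := fun x => by
      by_cases hx : γd (γe x) ∈ B
      · rw [indicator_of_mem hx, indicator_of_mem (show x ∈ S from hx)]
      · rw [indicator_of_notMem hx, indicator_of_notMem (show x ∉ S from hx)]
    have hL' : MemLp (fun x => x - γd (γe x) - S.indicator (fun _ => t) x) 2 P :=
      hL.sub (memLp_indicator_const 2 hSm t (Or.inr (measure_ne_top _ _)))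
    have h4 : ∫ x, (x - γd (γe x)) ^ 2 ∂P ≤
        ∫ x, (x - γd (γe x) - S.indicator (fun _ => t) x) ^ 2 ∂P := by
      simp only [decoderCost, hind, ← sub_sub] at h3
      rw [← ofReal_integral_eq_lintegral_ofReal hL.integrable_sq
        (Filter.Eventually.of_forall fun x => sq_nonneg _),
        ← ofReal_integral_eq_lintegral_ofReal hL'.integrable_sq
        (Filter.Eventually.of_forall fun x => sq_nonneg _),
        ENNReal.ofReal_le_ofReal_iff (integral_nonneg fun x => sq_nonneg _)] at h3
      exact h3
    have h5 : ∀ x, (x - γd (γe x) - S.indicator (fun _ => t) x) ^ 2 =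
        (x - γd (γe x)) ^ 2 - S.indicator (fun x => 2 * t * (x - γd (γe x)) - t ^ 2) x := fun x => by
      by_cases hx : x ∈ S
      · simp only [indicator_of_mem hx]; ring
      · simp only [indicator_of_notMem hx]; ring
    simp_rw [h5] at h4
    have hint' : Integrable (fun x => 2 * t * (x - γd (γe x)) - t ^ 2) P :=
      (hint.const_mul _).sub (integrable_const _)
    rw [integral_sub hL.integrable_sq (hint'.indicator hSm), integral_indicator hSm,
      integral_sub (hint.const_mul _).integrableOn (integrable_const _).integrableOn,
      integral_const_mul, setIntegral_const, smul_eq_mul] at h4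
    linarith
  -- The quadratic is tested near its optimum `I / p`; the `+ 1` covers `p = 0`.
  have h6 := key (I / (p + 1))
  have h7 : 2 * (I / (p + 1)) * I - (I / (p + 1)) ^ 2 * p = (I / (p + 1)) ^ 2 * (p + 2) := by
    field_simp
    ring
  have h8 : (I / (p + 1)) ^ 2 = 0 := by
    by_contra hne
    have : 0 < (I / (p + 1)) ^ 2 := lt_of_le_of_ne (sq_nonneg _) (Ne.symm hne)
    nlinarith
  have h9 := (div_eq_zero_iff.1 (pow_eq_zero_iff two_ne_zero |>.1 h8))
  exact h9.resolve_right (by linarith)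

end IsNashEquilibrium

/-! ### Equilibria with bins are the solutions of the centroid and indifference conditions. -/

namespace CentroidBins

variable {f : ℝ → ℝ} {L b : ℝ}

/-- The bins of an equilibrium satisfy the centroid and indifference conditions. -/
lemma of_isBinEquilibrium (hf : IsLogConcaveDensity f) (hL : tsupport f = Ici L) {n : ℕ}
    {m : Fin (n + 1 + 1) → EReal} {u : Fin (n + 1) → ℝ}
    (h : IsBinEquilibrium (sourceLaw f) b L ⊤ m u) : CentroidBins f b L m u := by
  obtain ⟨γe, γd, hN, hB⟩ := h
  have := hf.isProbabilityMeasure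
  have h2 := hf.memLp_id hL
  have hU := hN.measurable_action
  have hsub := bin_subset_Ici hB.edge_first hB.edge_strictMono
  have hvol := volume_bin_ne_zero hB.edge_first hB.edge_strictMono
  have hact : ∀ᵐ x ∂sourceLaw f, ∀ k, x ∈ bin m k → γd (γe x) = u k := ae_all_iff.2 hB.action_eq
  -- Bins cover the support and actions are distinct, so the event of taking action `u k` is the bin
  -- itself up to a null set.
  have hiff : ∀ᵐ x ∂sourceLaw f, ∀ k, (γd (γe x) = u k ↔ x ∈ bin m k) := by
    filter_upwards [hact, hf.ae_gt hL] with x hx hLx k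
    refine ⟨fun hk => ?_, hx k⟩
    obtain ⟨j, hj⟩ := exists_mem_bin hB.edge_first hB.edge_last hLx.le
    rwa [← hB.action_injective ((hx j hj).symm.trans hk)]
  have hcent : ∀ k, u k = centroid f (bin m k) := by
    intro k
    have h0 := hN.setIntegral_eq_zero h2 (measurableSet_singleton (u k))
    have h1 : ∫ x in {x | γd (γe x) ∈ ({u k} : Set ℝ)}, (x - γd (γe x)) ∂sourceLaw f =
        ∫ x in {x | γd (γe x) ∈ ({u k} : Set ℝ)}, (x - u k) ∂sourceLaw f :=
      setIntegral_congr_fun (hU (measurableSet_singleton (u k))) fun x hx => by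
        rw [show γd (γe x) = u k from hx]
    have h3 : ({x | γd (γe x) ∈ ({u k} : Set ℝ)} : Set ℝ) =ᵐ[sourceLaw f] bin m k := by
      filter_upwards [hiff] with x hx
      exact propext (hx k)
    rw [h1, setIntegral_congr_set h3, hf.setIntegral_sourceLaw (measurableSet_bin m k)] at h0
    exact ((hf.centroid_eq_iff hL (hf.setIntegral_pos hL (hsub k) (hvol k))).2 h0).symm
  have hrange : ∀ k, u k ∈ range γd := by
    intro k
    by_contra hk
    refine hf.sourceLaw_ne_zero hL (hsub k) (hvol k) (measure_mono_null ?_ (hB.action_eq k))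
    intro x hx hxk
    exact hk ⟨γe x, hxk hx⟩
  have hclose : ∀ j k, ∀ᵐ x ∂sourceLaw f, x ∈ bin m k → 0 ≤ |x - u j - b| - |x - u k - b| := by
    intro j k
    filter_upwards [hN.ae_closest h2, hact] with x hx hxa hxk
    have := hx _ (hrange j)
    rw [hxa k hxk] at this
    linarith
  have hcont : ∀ j k, Continuous fun x : ℝ => |x - u j - b| - |x - u k - b| := fun j k => by fun_prop
  refine ⟨hB.edge_first, hB.edge_last, hB.edge_strictMono, hcent, fun i => ?_⟩
  obtain ⟨a, hLa, ha⟩ := edge_real hB.edge_first hB.edge_strictMono i.castSucc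
  obtain ⟨e, hLe, he⟩ := edge_real hB.edge_first hB.edge_strictMono i.succ
  obtain ⟨z, hz, hzs⟩ := exists_Ioo_subset_bin hB.edge_strictMono he
  have hae : a < e := by
    have := hB.edge_strictMono (Fin.castSucc_lt_succ (i := i.castSucc))
    rw [ha] at this
    exact EReal.coe_lt_coe_iff.1 (this.trans_eq he)
  have hleft : bin m i.castSucc = Ico a e := bin_eq_Ico ha he
  -- Optimality in the bin to the left of `e` and just to its right extends by continuity to `e`,
  -- where the two inequalities become an equality of distances.
  have h1 := hf.nonneg_of_ae_Ioo hL hLa hae (hcont i.succ i.castSucc)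
    ((hclose i.succ i.castSucc).mono fun x hx hxI => hx (hleft ▸ Ioo_subset_Ico_self hxI)) e
    (right_mem_Icc.2 hae.le)
  have h3 := hf.nonneg_of_ae_Ioo hL hLe hz (hcont i.castSucc i.succ)
    ((hclose i.castSucc i.succ).mono fun x hx hxI => hx (hzs hxI)) e (left_mem_Icc.2 hz.le)
  have hne : u i.castSucc ≠ u i.succ := fun hu =>
    (Fin.castSucc_lt_succ (i := i)).ne (hB.action_injective hu)
  rw [he, EReal.coe_eq_coe_iff]
  rcases abs_eq_abs.1 (le_antisymm (sub_nonneg.1 h1) (sub_nonneg.1 h3)) with h | h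
  · exact absurd (by linarith) hne
  · linarith

/-- The actions increase, so comparing `u k` with its neighbour on the side of `j` through their
common edge suffices. -/
lemma abs_sub_le (hf : IsLogConcaveDensity f) (hL : tsupport f = Ici L) {n : ℕ}
    {m : Fin (n + 1 + 1) → EReal} {u : Fin (n + 1) → ℝ} (h : CentroidBins f b L m u)
    {j k : Fin (n + 1)} {x : ℝ} (hx : x ∈ bin m k) : |x - u k - b| ≤ |x - u j - b| := by
  have hmono := h.action_strictMono hf hL
  rcases lt_trichotomy j k with hjk | rfl | hjk
  · obtain ⟨i, rfl⟩ := Fin.eq_succ_of_ne_zero (ne_bot_of_gt hjk)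
    have h1 : u j ≤ u i.castSucc := hmono.monotone (Fin.le_castSucc_iff.2 hjk)
    have h2 := hx.1
    rw [h.indifferent i, EReal.coe_le_coe_iff] at h2
    have h3 := hmono hjk
    rw [abs_le]
    constructor
    · rw [abs_of_nonneg (by linarith)]; linarith
    · rw [abs_of_nonneg (by linarith)]; linarith
  · exact le_rfl
  · obtain ⟨i, rfl⟩ := Fin.eq_castSucc_of_ne_last (ne_top_of_lt hjk)
    have h1 : u i.succ ≤ u j := hmono.monotone (Fin.castSucc_lt_iff_succ_le.1 hjk)
    have h2 := hx.2
    have h4 := h.indifferent i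
    rw [Fin.succ_castSucc, h4, EReal.coe_lt_coe_iff] at h2
    have h3 := hmono hjk
    rw [abs_of_nonpos (a := x - u j - b) (by linarith), abs_le]
    constructor <;> linarith

/-- Bins that satisfy the centroid and indifference conditions come from an equilibrium, in which
the encoder announces the action and the decoder follows the announcement. -/
lemma isBinEquilibrium (hf : IsLogConcaveDensity f) (hL : tsupport f = Ici L) {n : ℕ}
    {m : Fin (n + 1 + 1) → EReal} {u : Fin (n + 1) → ℝ} (h : CentroidBins f b L m u) :
    IsBinEquilibrium (sourceLaw f) b L ⊤ m u := by
  classical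
  have := hf.isProbabilityMeasure
  have h2 := hf.memLp_id hL
  have hbm := measurableSet_bin m
  let γe : ℝ → ℝ := fun x => ∑ k, (bin m k).indicator (fun _ => u k) x
  -- Sending an unused message to `u 0` keeps all available actions among the `u k`, so encoder
  -- deviations gain nothing new.
  let γd : ℝ → ℝ := fun y => if y ∈ range u then y else u 0
  have hγe : Measurable γe := Finset.measurable_sum _ fun k _ => measurable_const.indicator (hbm k)
  have hγd : Measurable γd :=
    Measurable.ite (finite_range u).measurableSet measurable_id measurable_const
  have hγdr : ∀ y, ∃ j, γd y = u j := fun y => by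
    by_cases hy : y ∈ range u
    · obtain ⟨j, rfl⟩ := hy
      exact ⟨j, by simp [γd]⟩
    · exact ⟨0, by simp only [γd, if_neg hy]⟩
  have hγeu : ∀ k, ∀ x ∈ bin m k, γe x = u k := by
    intro k x hx
    refine (Finset.sum_eq_single k (fun j _ hj => ?_) (by simp)).trans (indicator_of_mem hx _)
    exact indicator_of_notMem (fun hxj => hj (bin_injective h.strictMono hxj hx)) _
  have hact : ∀ k, ∀ x ∈ bin m k, γd (γe x) = u k := fun k x hx => by
    rw [hγeu k x hx]
    simp [γd]
  have hcover : ∀ᵐ x ∂sourceLaw f, ∃ k, x ∈ bin m k :=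
    (hf.ae_gt hL).mono fun x hx => exists_mem_bin h.first h.last hx.le
  refine ⟨γe, γd, ⟨hγe, hγd, fun γ _ => ?_, fun γ hγ => ?_⟩,
    ⟨h.first, h.last, h.strictMono, (h.action_strictMono hf hL).injective,
      fun k => Filter.Eventually.of_forall (hact k)⟩⟩
  · refine lintegral_mono_ae ?_
    filter_upwards [hcover] with x ⟨k, hx⟩
    obtain ⟨j, hj⟩ := hγdr (γ x)
    refine ENNReal.ofReal_le_ofReal (sq_le_sq.2 ?_)
    rw [hact k x hx, hj]
    exact h.abs_sub_le hf hL hx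
  · have hdecomp : ∀ g : ℝ → ENNReal,
        ∫⁻ x, g x ∂sourceLaw f = ∑ k, ∫⁻ x in bin m k, g x ∂sourceLaw f := by
      intro g
      rw [← tsum_fintype (L := SummationFilter.unconditional _), ← lintegral_iUnion hbm fun j k hjk =>
        Set.disjoint_left.2 fun x hj hk => hjk (bin_injective h.strictMono hj hk),
        ← setLIntegral_univ]
      refine setLIntegral_congr ?_
      filter_upwards [hcover] with x hx
      exact propext ⟨fun _ => mem_iUnion.2 hx, fun _ => trivial⟩
    rw [decoderCost, decoderCost, hdecomp, hdecomp]
    refine Finset.sum_le_sum fun k _ => ?_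
    rw [setLIntegral_congr_fun (g := fun x => ENNReal.ofReal ((x - u k) ^ 2)) (hbm k)
      fun x hx => by simp only [hact k x hx],
      setLIntegral_congr_fun (f := fun x => ENNReal.ofReal ((x - γ (γe x)) ^ 2))
      (g := fun x => ENNReal.ofReal ((x - γ (u k)) ^ 2)) (hbm k)
      fun x hx => by simp only [hγeu k x hx]]
    have hint : ∀ v : ℝ, Integrable (fun x : ℝ => (x - v) ^ 2) (sourceLaw f) := fun v =>
      (h2.sub (memLp_const v)).integrable_sq
    rw [← ofReal_integral_eq_lintegral_ofReal (hint _).integrableOn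
      (Filter.Eventually.of_forall fun x => sq_nonneg _),
      ← ofReal_integral_eq_lintegral_ofReal (hint _).integrableOn
      (Filter.Eventually.of_forall fun x => sq_nonneg _)]
    refine ENNReal.ofReal_le_ofReal ?_
    have h0 : ∫ x in bin m k, (x - u k) ∂sourceLaw f = 0 := by
      rw [hf.setIntegral_sourceLaw (hbm k), h.eq_centroid k]
      exact hf.integral_centroid hL (hf.setIntegral_pos hL
        (bin_subset_Ici h.first h.strictMono k) (volume_bin_ne_zero h.first h.strictMono k))
    have hi1 : Integrable (fun x : ℝ => x - u k) (sourceLaw f) :=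
      (h2.sub (memLp_const (u k))).integrable one_le_two
    -- The added term has mean zero on the bin, and with it the integrand lies below `(x - γ (u k))
    -- ^ 2` by exactly `(u k - γ (u k)) ^ 2`.
    have h3 : ∫ x in bin m k, ((x - u k) ^ 2 + 2 * (u k - γ (u k)) * (x - u k)) ∂sourceLaw f =
        ∫ x in bin m k, (x - u k) ^ 2 ∂sourceLaw f := by
      rw [integral_add (hint _).integrableOn (hi1.const_mul _).integrableOn, integral_const_mul, h0,
        mul_zero, add_zero]
    rw [← h3]
    refine integral_mono ((hint _).add (hi1.const_mul _)).integrableOn (hint _).integrableOn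
      fun x => ?_
    simp only []
    nlinarith [sq_nonneg (u k - γ (u k))]

lemma hasUniqueEquilibrium (hf : IsLogConcaveDensity f) (hL : tsupport f = Ici L) {n : ℕ}
    (h : ∃ e, BinChain b (fun x y => centroid f (Ioo x y)) (fun x => centroid f (Ioi x) - x) n L e) :
    HasUniqueEquilibrium (sourceLaw f) b L ⊤ (n + 1) := by
  obtain ⟨e, he⟩ := h
  obtain ⟨m, u, hmu, -⟩ := exists_of_binChain he
  refine ⟨(m, u), hmu.isBinEquilibrium hf hL, fun q hq => ?_⟩
  obtain ⟨h1, h2⟩ := unique hf hL le_rfl (of_isBinEquilibrium hf hL hq) hmu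
  exact Prod.ext h1 h2

end CentroidBins

/-! ### Finiteness of the set of actions for negative bias. -/

namespace IsNashEquilibrium

variable {f : ℝ → ℝ} {L b : ℝ} {γe γd : ℝ → ℝ}

/-- The actions that are taken with positive probability. -/
def usedActions (P : Measure ℝ) (γe γd : ℝ → ℝ) : Set ℝ := {u | P {x | γd (γe x) = u} ≠ 0}

/-- Among the source values with a given property of full measure that induce an action in `B`,
some are at least and some are at most their action. -/
lemma exists_le_and_ge {P : Measure ℝ} [IsFiniteMeasure P] (h : IsNashEquilibrium P b γe γd)
    (h2 : MemLp (fun x : ℝ => x) 2 P) {B : Set ℝ} (hB : MeasurableSet B)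
    (hPB : P {x | γd (γe x) ∈ B} ≠ 0) {p : ℝ → Prop} (hp : ∀ᵐ x ∂P, p x) :
    (∃ x, p x ∧ γd (γe x) ∈ B ∧ γd (γe x) ≤ x) ∧ ∃ x, p x ∧ γd (γe x) ∈ B ∧ x ≤ γd (γe x) := by
  set S := {x | γd (γe x) ∈ B} with hS
  have hSm : MeasurableSet S := h.measurable_action hB
  have hint : Integrable (fun x => x - γd (γe x)) (P.restrict S) :=
    ((h.memLp_action h2).integrable one_le_two).integrableOn
  have hne : P.restrict S ≠ 0 := by rwa [Ne, Measure.restrict_eq_zero]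
  have hN : P.restrict S {x | ¬ (p x ∧ x ∈ S)} = 0 :=
    ae_iff.1 ((ae_restrict_of_ae hp).and (ae_restrict_mem hSm))
  have havg : ⨍ x, (x - γd (γe x)) ∂P.restrict S = 0 := by
    rw [average_eq, h.setIntegral_eq_zero h2 hB, smul_zero]
  obtain ⟨x, hx, hx'⟩ := exists_notMem_null_average_le hne hint hN
  obtain ⟨y, hy, hy'⟩ := exists_notMem_null_le_average hne hint hN
  rw [havg] at hx' hy'
  obtain ⟨hpx, hSx⟩ := not_not.1 hx
  obtain ⟨hpy, hSy⟩ := not_not.1 hy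
  exact ⟨⟨x, hpx, hSx, by linarith⟩, ⟨y, hpy, hSy, by linarith⟩⟩

/-- Squaring cancels the quadratic terms and leaves the positive factor `U x' - U x` times a linear
expression. -/
lemma le_midpoint {U : ℝ → ℝ} {x x' : ℝ} (hlt : U x < U x')
    (h : |x - U x - b| ≤ |x - U x' - b|) (h' : |x' - U x' - b| ≤ |x' - U x - b|) :
    x - b ≤ (U x + U x') / 2 ∧ (U x + U x') / 2 ≤ x' - b := by
  have h1 := sq_le_sq.2 h
  have h2 := sq_le_sq.2 h'
  constructor <;> nlinarith

/-- Actions are conditional means, so two disjoint classes of actions of positive probability each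
contain a source value at or above its action. For the lower action `u` this gives `u ≤ x ≤ (u + v)
/ 2 + b`, so `v ≥ u - 2b`, too far apart for `J`. Every measurable class in `J` is thus null or
full, which forces an almost surely constant action. -/
lemma ae_const_of_mem_Ico {P : Measure ℝ} [IsFiniteMeasure P] (h : IsNashEquilibrium P b γe γd)
    (h2 : MemLp (fun x : ℝ => x) 2 P) (a : ℝ) :
    ∃ v, ∀ᵐ x ∂P, γd (γe x) ∈ Ico a (a - 2 * b) → γd (γe x) = v := by
  have hU := h.measurable_action
  set J := Ico a (a - 2 * b) with hJ
  have hSm : MeasurableSet {x | γd (γe x) ∈ J} := hU measurableSet_Ico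
  have key : ∀ V : Set ℝ, MeasurableSet V →
      (∀ᵐ x ∂P.restrict {x | γd (γe x) ∈ J}, γd (γe x) ∈ V) ∨
      (∀ᵐ x ∂P.restrict {x | γd (γe x) ∈ J}, γd (γe x) ∉ V) := by
    intro V hV
    by_contra hcon
    rw [not_or, ae_restrict_iff' hSm, ae_restrict_iff' hSm] at hcon
    have h1 : P {x | γd (γe x) ∈ J \ V} ≠ 0 := fun h0 => hcon.1 <| by
      rw [ae_iff]
      convert h0 using 2
      ext x
      simp
    have h3 : P {x | γd (γe x) ∈ J ∩ V} ≠ 0 := fun h0 => hcon.2 <| by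
      rw [ae_iff]
      convert h0 using 2
      ext x
      simp
    have hc := h.ae_closest h2
    obtain ⟨⟨x, hx, hxB, hxle⟩, -⟩ :=
      h.exists_le_and_ge h2 (measurableSet_Ico.diff hV) h1 hc
    obtain ⟨⟨y, hy, hyB, hyle⟩, -⟩ :=
      h.exists_le_and_ge h2 (measurableSet_Ico.inter hV) h3 hc
    rcases lt_trichotomy (γd (γe x)) (γd (γe y)) with hlt | heq | hlt
    · have := (le_midpoint (U := fun x => γd (γe x)) hlt (hx _ ⟨_, rfl⟩) (hy _ ⟨_, rfl⟩)).1
      linarith [hxB.1.1, hyB.1.2]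
    · exact hxB.2 (heq ▸ hyB.2)
    · have := (le_midpoint (U := fun x => γd (γe x)) hlt (hy _ ⟨_, rfl⟩) (hx _ ⟨_, rfl⟩)).1
      linarith [hyB.1.1, hxB.1.2]
  obtain ⟨v, hv⟩ := Filter.exists_eventuallyEq_const_of_forall_separating MeasurableSet key
  exact ⟨v, (ae_restrict_iff' hSm).1 hv⟩

lemma ae_mem_usedActions {P : Measure ℝ} [IsFiniteMeasure P] (h : IsNashEquilibrium P b γe γd)
    (h2 : MemLp (fun x : ℝ => x) 2 P) (hb : b < 0) :
    ∀ᵐ x ∂P, γd (γe x) ∈ usedActions P γe γd := by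
  -- The line is tiled by intervals of length `-2b`, each carrying at most one action up to null
  -- sets.
  choose v hv using fun n : ℤ => h.ae_const_of_mem_Ico h2 (n * (-2 * b))
  have h1 : ∀ n : ℤ, ∀ᵐ x ∂P, γd (γe x) = v n → v n ∈ usedActions P γe γd := by
    intro n
    by_cases hn : v n ∈ usedActions P γe γd
    · exact Filter.Eventually.of_forall fun _ _ => hn
    · have h0 : P {x | γd (γe x) = v n} = 0 := not_not.1 hn
      refine measure_mono_null (fun x hx => ?_) h0
      by_contra hne
      exact hx fun heq => absurd heq hne
  filter_upwards [ae_all_iff.2 hv, ae_all_iff.2 h1] with x hx hx'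
  have hb' : 0 < -2 * b := by linarith
  have hmem : γd (γe x) ∈ Ico ((⌊γd (γe x) / (-2 * b)⌋ : ℝ) * (-2 * b))
      (⌊γd (γe x) / (-2 * b)⌋ * (-2 * b) - 2 * b) := by
    have e1 := (le_div_iff₀ hb').1 (Int.floor_le (γd (γe x) / (-2 * b)))
    have e2 := (div_lt_iff₀ hb').1 (Int.lt_floor_add_one (γd (γe x) / (-2 * b)))
    exact ⟨e1, by linarith⟩
  have := hx _ hmem
  rw [this]
  exact hx' _ this

/-- Source values above `L` that induce a used action and satisfy the encoder's optimality. -/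
def Typical (P : Measure ℝ) (L b : ℝ) (γe γd : ℝ → ℝ) (x : ℝ) : Prop :=
  L < x ∧ γd (γe x) ∈ usedActions P γe γd ∧ ∀ a ∈ range γd, |x - γd (γe x) - b| ≤ |x - a - b|

lemma Typical.midpoint {P : Measure ℝ} {x x' : ℝ} (hx : Typical P L b γe γd x)
    (hx' : Typical P L b γe γd x') (hlt : γd (γe x) < γd (γe x')) :
    x - b ≤ (γd (γe x) + γd (γe x')) / 2 ∧ (γd (γe x) + γd (γe x')) / 2 ≤ x' - b :=
  le_midpoint (U := fun x => γd (γe x)) hlt (hx.2.2 _ ⟨_, rfl⟩) (hx'.2.2 _ ⟨_, rfl⟩)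

lemma ae_typical (h : IsNashEquilibrium (sourceLaw f) b γe γd) (hf : IsLogConcaveDensity f)
    (hL : tsupport f = Ici L) (hb : b < 0) :
    ∀ᵐ x ∂sourceLaw f, Typical (sourceLaw f) L b γe γd x := by
  have := hf.isProbabilityMeasure
  have h2 := hf.memLp_id hL
  filter_upwards [hf.ae_gt hL, h.ae_mem_usedActions h2 hb, h.ae_closest h2] with x h1 h2 h3
  exact ⟨h1, h2, h3⟩

lemma exists_typical (h : IsNashEquilibrium (sourceLaw f) b γe γd) (hf : IsLogConcaveDensity f)
    (hL : tsupport f = Ici L) (hb : b < 0) {u : ℝ} (hu : u ∈ usedActions (sourceLaw f) γe γd) :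
    (∃ x, Typical (sourceLaw f) L b γe γd x ∧ γd (γe x) = u ∧ u ≤ x) ∧
      ∃ x, Typical (sourceLaw f) L b γe γd x ∧ γd (γe x) = u ∧ x ≤ u := by
  have := hf.isProbabilityMeasure
  obtain ⟨⟨x, hx, rfl, hx'⟩, ⟨y, hy, hyu, hy'⟩⟩ := h.exists_le_and_ge (hf.memLp_id hL)
    (measurableSet_singleton u) hu (h.ae_typical hf hL hb)
  exact ⟨⟨x, hx, rfl, hx'⟩, ⟨y, hy, hyu, hyu ▸ hy'⟩⟩

lemma lt_of_mem_usedActions (h : IsNashEquilibrium (sourceLaw f) b γe γd)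
    (hf : IsLogConcaveDensity f) (hL : tsupport f = Ici L) (hb : b < 0) {u : ℝ}
    (hu : u ∈ usedActions (sourceLaw f) γe γd) : L < u := by
  obtain ⟨-, x, hx, -, hxu⟩ := h.exists_typical hf hL hb hu
  exact hx.1.trans_le hxu

/-- A typical source value at or above its action `u` cannot lie beyond the indifference point with
`v`. -/
lemma usedActions_gap (h : IsNashEquilibrium (sourceLaw f) b γe γd)
    (hf : IsLogConcaveDensity f) (hL : tsupport f = Ici L) (hb : b < 0) {u v : ℝ}
    (hu : u ∈ usedActions (sourceLaw f) γe γd) (hv : v ∈ usedActions (sourceLaw f) γe γd)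
    (huv : u < v) : u - 2 * b ≤ v := by
  obtain ⟨⟨x, hx, rfl, hxu⟩, -⟩ := h.exists_typical hf hL hb hu
  obtain ⟨⟨y, hy, rfl, -⟩, -⟩ := h.exists_typical hf hL hb hv
  linarith [(hx.midpoint hy huv).1]

lemma usedActions_inter_Iic_finite (h : IsNashEquilibrium (sourceLaw f) b γe γd)
    (hf : IsLogConcaveDensity f) (hL : tsupport f = Ici L) (hb : b < 0) (c : ℝ) :
    (usedActions (sourceLaw f) γe γd ∩ Iic c).Finite := by
  have hb' : 0 < -2 * b := by linarith
  refine Set.Finite.of_injOn (f := fun u : ℝ => ⌊u / (-2 * b)⌋)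
    (t := Icc ⌊L / (-2 * b)⌋ ⌊c / (-2 * b)⌋) (fun u hu => ?_) ?_ (finite_Icc _ _)
  · have h1 := h.lt_of_mem_usedActions hf hL hb hu.1
    have h2 : u ≤ c := hu.2
    exact ⟨Int.floor_le_floor (div_le_div_of_nonneg_right h1.le hb'.le),
      Int.floor_le_floor (div_le_div_of_nonneg_right h2 hb'.le)⟩
  · have aux : ∀ u ∈ usedActions (sourceLaw f) γe γd, ∀ v ∈ usedActions (sourceLaw f) γe γd,
        ⌊u / (-2 * b)⌋ = ⌊v / (-2 * b)⌋ → ¬ u < v := by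
      intro u hu v hv huv hlt
      have h1 := h.usedActions_gap hf hL hb hu hv hlt
      have h2 := (div_lt_iff₀ hb').1 (Int.lt_floor_add_one (v / (-2 * b)))
      have h3 := (le_div_iff₀ hb').1 (Int.floor_le (u / (-2 * b)))
      rw [huv] at h3
      linarith
    intro u hu v hv huv
    exact le_antisymm (not_lt.1 (aux v hv.1 u hu.1 huv.symm)) (not_lt.1 (aux u hu.1 v hv.1 huv))

lemma exists_next (h : IsNashEquilibrium (sourceLaw f) b γe γd)
    (hf : IsLogConcaveDensity f) (hL : tsupport f = Ici L) (hb : b < 0)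
    (hinf : (usedActions (sourceLaw f) γe γd).Infinite) (c : ℝ) :
    ∃ v ∈ usedActions (sourceLaw f) γe γd, c < v ∧
      ∀ w ∈ usedActions (sourceLaw f) γe γd, c < w → v ≤ w := by
  obtain ⟨w₀, hw₀, hcw₀⟩ : ∃ w ∈ usedActions (sourceLaw f) γe γd, c < w := by
    by_contra! hcon
    exact hinf ((h.usedActions_inter_Iic_finite hf hL hb c).subset fun w hw => ⟨hw, hcon w hw⟩)
  obtain ⟨v, hv, hmin⟩ := Set.exists_min_image
    (usedActions (sourceLaw f) γe γd ∩ Iic w₀ ∩ Ioi c) id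
    ((h.usedActions_inter_Iic_finite hf hL hb w₀).subset inter_subset_left)
    ⟨w₀, ⟨hw₀, self_mem_Iic⟩, hcw₀⟩
  refine ⟨v, hv.1.1, hv.2, fun w hw hcw => ?_⟩
  rcases le_total w w₀ with hle | hle
  · exact hmin w ⟨⟨hw, hle⟩, hcw⟩
  · exact (hmin w₀ ⟨⟨hw₀, self_mem_Iic⟩, hcw₀⟩).trans hle

/-- Between its two neighbours, a used action is the centroid of the interval cut out by the
indifference points. -/
lemma eq_centroid_of_consecutive (h : IsNashEquilibrium (sourceLaw f) b γe γd)
    (hf : IsLogConcaveDensity f) (hL : tsupport f = Ici L) (hb : b < 0) {u v w : ℝ}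
    (hu : u ∈ usedActions (sourceLaw f) γe γd) (hv : v ∈ usedActions (sourceLaw f) γe γd)
    (hw : w ∈ usedActions (sourceLaw f) γe γd) (huv : u < v) (hvw : v < w)
    (hv' : ∀ t ∈ usedActions (sourceLaw f) γe γd, u < t → v ≤ t)
    (hw' : ∀ t ∈ usedActions (sourceLaw f) γe γd, v < t → w ≤ t) :
    v = centroid f (Ioo ((u + v) / 2 + b) ((v + w) / 2 + b)) := by
  have := hf.isProbabilityMeasure
  have hLu := h.lt_of_mem_usedActions hf hL hb hu
  have hgap := h.usedActions_gap hf hL hb hu hv huv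
  obtain ⟨⟨x₁, hx₁, rfl, -⟩, -⟩ := h.exists_typical hf hL hb hu
  obtain ⟨⟨x₂, hx₂, rfl, -⟩, -⟩ := h.exists_typical hf hL hb hv
  obtain ⟨⟨x₃, hx₃, rfl, -⟩, -⟩ := h.exists_typical hf hL hb hw
  set u := γd (γe x₁)
  set v := γd (γe x₂)
  set w := γd (γe x₃)
  have hne := IsLogConcaveDensity.ae_ne f
  -- Inside the interval a lower action would be at most `u` and a higher one at least `w`, each
  -- beaten by `v`; the two indifference points are discarded as null.
  have hset : ({x | γd (γe x) ∈ ({v} : Set ℝ)} : Set ℝ) =ᵐ[sourceLaw f]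
      Ioo ((u + v) / 2 + b) ((v + w) / 2 + b) := by
    filter_upwards [h.ae_typical hf hL hb, hne ((u + v) / 2 + b), hne ((v + w) / 2 + b)]
      with x hx hxp hxq
    refine propext ⟨fun hxv => ?_, fun hxI => ?_⟩
    · have hxv : γd (γe x) = v := hxv
      have h1 := (hx₁.midpoint hx (hxv ▸ huv)).2
      have h2 := (hx.midpoint hx₃ (hxv ▸ hvw)).1
      rw [hxv] at h1 h2
      exact ⟨lt_of_le_of_ne (by linarith) hxp.symm, lt_of_le_of_ne (by linarith) hxq⟩
    · rcases lt_trichotomy (γd (γe x)) v with hlt | heq | hlt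
      · have h1 : γd (γe x) ≤ u := by
          by_contra! hcon
          exact absurd hlt (not_lt.2 (hv' _ hx.2.1 hcon))
        linarith [(hx.midpoint hx₂ hlt).1, hxI.1]
      · exact heq
      · have h1 := hw' _ hx.2.1 hlt
        linarith [(hx₂.midpoint hx hlt).2, hxI.2]
  have h0 := h.setIntegral_eq_zero (hf.memLp_id hL) (measurableSet_singleton v)
  have h1 : ∫ x in {x | γd (γe x) ∈ ({v} : Set ℝ)}, (x - γd (γe x)) ∂sourceLaw f =
      ∫ x in {x | γd (γe x) ∈ ({v} : Set ℝ)}, (x - v) ∂sourceLaw f :=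
    setIntegral_congr_fun (h.measurable_action (measurableSet_singleton v)) fun x hx => by
      rw [show γd (γe x) = v from hx]
  rw [h1, setIntegral_congr_set hset, hf.setIntegral_sourceLaw measurableSet_Ioo] at h0
  refine ((hf.centroid_eq_iff hL (hf.setIntegral_pos hL (fun t ht => ?_) ?_)).2 h0).symm
  · simp only [mem_Ici]
    linarith [ht.1]
  · simp only [Real.volume_Ioo, ne_eq, ENNReal.ofReal_eq_zero, not_le]
    linarith

/-- Beyond the point from which the density decreases, the gaps between consecutive actions grow
by a fixed amount, yet they are bounded by the mean residual; so there are finitely many. -/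
lemma usedActions_finite (h : IsNashEquilibrium (sourceLaw f) b γe γd)
    (hf : IsLogConcaveDensity f) (hL : tsupport f = Ici L) (hb : b < 0) :
    (usedActions (sourceLaw f) γe γd).Finite := by
  by_contra hinf
  obtain ⟨X, hLX, hX, -⟩ := hf.exists_tail hL
  have hsys := hf.centroidSystem hL
  have hnext := h.exists_next hf hL hb hinf
  have key : ∀ n : ℕ, ∃ u ∈ usedActions (sourceLaw f) γe γd, ∃ v ∈ usedActions (sourceLaw f) γe γd,
      X ≤ u ∧ u < v ∧ (∀ t ∈ usedActions (sourceLaw f) γe γd, u < t → v ≤ t) ∧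
      -4 * b * n ≤ v - u ∧ v - u ≤ 2 * (centroid f (Ioi L) - L) := by
    have bound : ∀ u ∈ usedActions (sourceLaw f) γe γd, ∀ v ∈ usedActions (sourceLaw f) γe γd,
        X ≤ u → u < v → (∀ t ∈ usedActions (sourceLaw f) γe γd, u < t → v ≤ t) →
        v - u ≤ 2 * (centroid f (Ioi L) - L) ∧ ∃ w ∈ usedActions (sourceLaw f) γe γd, v < w ∧
          (∀ t ∈ usedActions (sourceLaw f) γe γd, v < t → w ≤ t) ∧ v - u - 4 * b ≤ w - v := by
      intro u hu v hv hXu huv hv'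
      obtain ⟨w, hw, hvw, hw'⟩ := hnext v
      have hc := h.eq_centroid_of_consecutive hf hL hb hu hv hw huv hvw hv' hw'
      have hgap := h.usedActions_gap hf hL hb hu hv huv
      have hpq : (u + v) / 2 + b < (v + w) / 2 + b := by linarith
      -- The gap `v - u ≥ -2b` puts the indifference point at or above `u`, hence in the decreasing
      -- range.
      have hXp : X ≤ (u + v) / 2 + b := by linarith
      -- The midpoint bound on the centroid `v` rearranges to growth of the gap by `-4b`; the
      -- mean-residual bound on it caps the gap.
      have h1 := hf.centroid_le_midpoint hL hX hLX.le hXp hpq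
      have h2 := hsys.lt_tail (hLX.le.trans hXp) hpq
      have h3 := hsys.tail_anti le_rfl (hLX.le.trans hXp)
      rw [← hc] at h1 h2
      exact ⟨by linarith, w, hw, hvw, hw', by linarith⟩
    intro n
    induction n with
    | zero =>
      obtain ⟨u, hu, hXu, -⟩ := hnext X
      obtain ⟨v, hv, huv, hv'⟩ := hnext u
      refine ⟨u, hu, v, hv, hXu.le, huv, hv', ?_, (bound u hu v hv hXu.le huv hv').1⟩
      simpa using huv.le
    | succ n ih =>
      obtain ⟨u, hu, v, hv, hXu, huv, hv', hn, -⟩ := ih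
      obtain ⟨-, w, hw, hvw, hw', hgrow⟩ := bound u hu v hv hXu huv hv'
      refine ⟨v, hv, w, hw, hXu.trans huv.le, hvw, hw', ?_,
        (bound v hv w hw (hXu.trans huv.le) hvw hw').1⟩
      push_cast
      linarith
  obtain ⟨n, hn⟩ := exists_nat_gt (2 * (centroid f (Ioi L) - L) / (-4 * b))
  rw [div_lt_iff₀ (by linarith)] at hn
  obtain ⟨u, -, v, -, -, -, -, h1, h2⟩ := key n
  linarith

lemma exists_hasBins (h : IsNashEquilibrium (sourceLaw f) b γe γd)
    (hf : IsLogConcaveDensity f) (hL : tsupport f = Ici L) (hb : b < 0) :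
    ∃ (N : ℕ) (m : Fin (N + 1) → EReal) (u : Fin N → ℝ),
      HasBins (sourceLaw f) L ⊤ γe γd m u := by
  have := hf.isProbabilityMeasure
  have hfin := h.usedActions_finite hf hL hb
  obtain ⟨x₀, hx₀⟩ := (h.ae_typical hf hL hb).exists
  obtain ⟨n, hn⟩ : ∃ n, hfin.toFinset.card = n + 1 :=
    Nat.exists_eq_succ_of_ne_zero (Finset.card_ne_zero_of_mem (hfin.mem_toFinset.2 hx₀.2.1))
  let u : Fin (n + 1) → ℝ := hfin.toFinset.orderEmbOfFin hn
  have hmono : StrictMono u := (hfin.toFinset.orderEmbOfFin hn).strictMono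
  have hmem : ∀ k, u k ∈ usedActions (sourceLaw f) γe γd := fun k =>
    hfin.mem_toFinset.1 (hfin.toFinset.orderEmbOfFin_mem hn k)
  have hsurj : ∀ v ∈ usedActions (sourceLaw f) γe γd, ∃ k, u k = v := fun v hv => by
    have : v ∈ range (hfin.toFinset.orderEmbOfFin hn) := by
      rw [Finset.range_orderEmbOfFin]
      exact hfin.mem_toFinset.2 hv
    exact this
  let e : Fin n → ℝ := fun i => (u i.castSucc + u i.succ) / 2 + b
  -- The edges are `L`, the indifference points of consecutive actions, and `⊤`.
  let m : Fin (n + 1 + 1) → EReal :=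
    Fin.cons (L : EReal) (Fin.snoc (α := fun _ => EReal) (fun i => (e i : EReal)) ⊤)
  have hm0 : m 0 = L := rfl
  have hmlast : m (Fin.last (n + 1)) = ⊤ := by
    change Fin.snoc (α := fun _ => EReal) (fun i => (e i : EReal)) ⊤ (Fin.last n) = ⊤
    exact Fin.snoc_last _ _
  have hme : ∀ i : Fin n, m i.castSucc.succ = e i := fun i => by
    change Fin.snoc (α := fun _ => EReal) (fun i => (e i : EReal)) ⊤ i.castSucc = _
    exact Fin.snoc_castSucc _ _ _
  have hgap : ∀ i : Fin n, u i.castSucc - 2 * b ≤ u i.succ := fun i =>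
    h.usedActions_gap hf hL hb (hmem _) (hmem _) (hmono Fin.castSucc_lt_succ)
  have hm : StrictMono m := by
    rw [Fin.strictMono_iff_lt_succ]
    intro k
    -- Each action separates its two edges: `b < 0` places it above the left one, and the gap of
    -- `-2b` places it at or below the right one.
    have h1 : m k.castSucc < u k := by
      refine Fin.cases ?_ (fun i => ?_) k
      · rw [Fin.castSucc_zero, hm0, EReal.coe_lt_coe_iff]
        exact h.lt_of_mem_usedActions hf hL hb (hmem 0)
      · rw [← Fin.succ_castSucc, hme, EReal.coe_lt_coe_iff]
        have := hmono (Fin.castSucc_lt_succ (i := i))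
        simp only [e]
        linarith
    have h2 : (u k : EReal) ≤ m k.succ := by
      refine Fin.lastCases ?_ (fun i => ?_) k
      · rw [Fin.succ_last, hmlast]
        exact le_top
      · rw [hme, EReal.coe_le_coe_iff]
        simp only [e]
        linarith [hgap i]
    exact h1.trans_le h2
  refine ⟨n + 1, m, u, hm0, hmlast, hm, hmono.injective, fun k => ?_⟩
  have hne : ∀ᵐ x ∂sourceLaw f, ∀ i : Fin n, x ≠ e i := ae_all_iff.2 fun i =>
    IsLogConcaveDensity.ae_ne f (e i)
  obtain ⟨⟨y, hy, hyk, -⟩, -⟩ := h.exists_typical hf hL hb (hmem k)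
  filter_upwards [h.ae_typical hf hL hb, hne] with x hx hxe hxk
  obtain ⟨j, hj⟩ := hsurj _ hx.2.1
  rcases lt_trichotomy j k with hjk | rfl | hjk
  · obtain ⟨i, rfl⟩ := Fin.eq_succ_of_ne_zero (ne_bot_of_gt hjk)
    have h1 : u j ≤ u i.castSucc := hmono.monotone (Fin.le_castSucc_iff.2 hjk)
    have h2 := hxk.1
    rw [← Fin.succ_castSucc, hme, EReal.coe_le_coe_iff] at h2
    have h3 := (hx.midpoint hy (by rw [← hj, hyk]; exact hmono hjk)).1
    rw [← hj, hyk] at h3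
    refine absurd (le_antisymm ?_ h2) (hxe i)
    simp only [e]
    linarith
  · exact hj.symm
  · obtain ⟨i, rfl⟩ := Fin.eq_castSucc_of_ne_last (ne_top_of_lt hjk)
    have h1 : u i.succ ≤ u j := hmono.monotone (Fin.castSucc_lt_iff_succ_le.1 hjk)
    have h2 := hxk.2
    rw [hme, EReal.coe_lt_coe_iff] at h2
    have h3 := (hy.midpoint hx (by rw [← hj, hyk]; exact hmono hjk)).2
    rw [← hj, hyk] at h3
    simp only [e] at h2
    linarith

end IsNashEquilibrium

/-! ### The theorem for support unbounded to the right. -/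

section HalfLine

variable {f : ℝ → ℝ} {L b : ℝ}

lemma hasUniqueEquilibrium_of_pos (hf : IsLogConcaveDensity f) (hL : tsupport f = Ici L)
    (hb : 0 < b) {N : ℕ} (hN : 1 ≤ N) : HasUniqueEquilibrium (sourceLaw f) b L ⊤ N := by
  obtain ⟨n, rfl⟩ := Nat.exists_eq_add_of_le' hN
  exact CentroidBins.hasUniqueEquilibrium hf hL
    (BinChain.exists_of_pos (hf.centroidSystem hL) hb n le_rfl)

lemma exists_binBound_of_neg (hf : IsLogConcaveDensity f) (hL : tsupport f = Ici L) (hb : b < 0) :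
    ∃ Nmax : ℕ, 1 ≤ Nmax ∧ IsBinBound (sourceLaw f) b L ⊤ Nmax ∧
      ∀ N : ℕ, 1 ≤ N → N ≤ Nmax → HasUniqueEquilibrium (sourceLaw f) b L ⊤ N := by
  have hsys := hf.centroidSystem hL
  obtain ⟨X, hLX, hX, -⟩ := hf.exists_tail hL
  let S : Set ℕ := {n | ∃ e,
    BinChain b (fun x y => centroid f (Ioo x y)) (fun x => centroid f (Ioi x) - x) n L e}
  have hne : S.Nonempty := ⟨0, _, BinChain.last L⟩
  have hbdd : BddAbove S := by
    obtain ⟨K, hK⟩ := exists_nat_gt ((2 * (centroid f (Ioi L) - L) + (X - L)) / (-2 * b))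
    refine ⟨K, fun n ⟨e, he⟩ => ?_⟩
    have h1 := he.length_bound hsys hLX.le
      (fun hx hxy => hf.centroid_le_midpoint hL hX hLX.le hx hxy) le_rfl hLX.le
    have h2 := he.pos hsys le_rfl
    rw [div_lt_iff₀ (by linarith)] at hK
    have h3 : (n : ℝ) < K := by
      by_contra! hcon
      nlinarith
    exact_mod_cast h3.le
  -- `S` counts interior edges, one fewer than the bins.
  refine ⟨sSup S + 1, by omega, ⟨fun γe γd h => h.exists_hasBins hf hL hb, fun N m u h => ?_⟩,
    fun N hN hle => ?_⟩
  · cases N with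
    | zero => omega
    | succ n =>
      have := le_csSup hbdd (show n ∈ S from ⟨_, (CentroidBins.of_isBinEquilibrium hf hL h).binChain⟩)
      omega
  · obtain ⟨n, rfl⟩ := Nat.exists_eq_add_of_le' hN
    exact CentroidBins.hasUniqueEquilibrium hf hL
      (BinChain.exists_of_le_length hsys (by omega) (Nat.sSup_mem hne hbdd))

end HalfLine

/-! ### Reflection of the source, which exchanges the half-lines and the sign of the bias. -/

section Reflection

variable {P P' : Measure ℝ} {b : ℝ} {lo hi : EReal} {γe γd : ℝ → ℝ}

lemma encoderCost_neg (hP : MeasurePreserving (fun x : ℝ => -x) P' P) (b : ℝ) (γe γd : ℝ → ℝ) :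
    encoderCost P' (-b) (fun x => γe (-x)) (fun y => -γd y) = encoderCost P b γe γd := by
  rw [encoderCost, encoderCost,
    ← hP.lintegral_comp_emb (MeasurableEquiv.neg ℝ).measurableEmbedding]
  refine lintegral_congr fun x => ?_
  congr 1
  ring

lemma decoderCost_neg (hP : MeasurePreserving (fun x : ℝ => -x) P' P) (γe γd : ℝ → ℝ) :
    decoderCost P' (fun x => γe (-x)) (fun y => -γd y) = decoderCost P γe γd := by
  rw [decoderCost, decoderCost,
    ← hP.lintegral_comp_emb (MeasurableEquiv.neg ℝ).measurableEmbedding]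
  refine lintegral_congr fun x => ?_
  congr 1
  ring

lemma IsNashEquilibrium.neg (hP : MeasurePreserving (fun x : ℝ => -x) P' P)
    (h : IsNashEquilibrium P b γe γd) :
    IsNashEquilibrium P' (-b) (fun x => γe (-x)) (fun y => -γd y) := by
  refine ⟨h.measurable_encoder.comp measurable_neg, h.measurable_decoder.neg, fun γ hγ => ?_,
    fun γ hγ => ?_⟩
  · have h1 := h.encoder_optimal (fun x => γ (-x)) (hγ.comp measurable_neg)
    rw [← encoderCost_neg hP, ← encoderCost_neg hP] at h1
    simpa using h1
  · have h1 := h.decoder_optimal (fun y => -γ y) hγ.neg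
    rw [← decoderCost_neg hP, ← decoderCost_neg hP] at h1
    simpa using h1

lemma HasBins.neg [NullSingletonClass P'] (hP : MeasurePreserving (fun x : ℝ => -x) P' P) {N : ℕ}
    {m : Fin (N + 1) → EReal} {u : Fin N → ℝ} (h : HasBins P lo hi γe γd m u) :
    HasBins P' (-hi) (-lo) (fun x => γe (-x)) (fun y => -γd y) (fun i => -m i.rev)
      (fun k => -u k.rev) := by
  refine ⟨?_, ?_, ?_, ?_, fun k => ?_⟩
  · rw [Fin.rev_zero, h.edge_last]
  · rw [Fin.rev_last, h.edge_first]
  · exact fun i j hij => EReal.neg_lt_neg_iff.2 (h.edge_strictMono (Fin.rev_lt_rev.2 hij))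
  · exact fun i j hij => Fin.rev_injective (h.action_injective (neg_injective hij))
  · have h1 := hP.quasiMeasurePreserving.ae (h.action_eq k.rev)
    -- Reflected half-open bins are closed on the other side, so one point must be discarded. For an
    -- infinite edge `toReal` discards a harmless point.
    have h2 : ∀ᵐ x ∂P', x ≠ -(m k.rev.succ).toReal := by simp [ae_iff]
    filter_upwards [h1, h2] with x hx hne hxk
    rw [hx ?_]
    obtain ⟨hlo, hhi⟩ := hxk
    simp only [Fin.rev_castSucc] at hlo
    simp only [Fin.rev_succ] at hhi
    refine ⟨?_, lt_of_le_of_ne ?_ fun heq => hne ?_⟩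
    · rw [EReal.coe_neg]; exact (EReal.lt_neg_comm.1 hhi).le
    · rw [EReal.coe_neg]; exact EReal.neg_le.1 hlo
    · rw [← heq]; simp

lemma IsBinEquilibrium.neg [NullSingletonClass P'] (hP : MeasurePreserving (fun x : ℝ => -x) P' P) {N : ℕ}
    {m : Fin (N + 1) → EReal} {u : Fin N → ℝ} (h : IsBinEquilibrium P b lo hi m u) :
    IsBinEquilibrium P' (-b) (-hi) (-lo) (fun i => -m i.rev) (fun k => -u k.rev) := by
  obtain ⟨γe, γd, h1, h2⟩ := h
  exact ⟨_, _, h1.neg hP, h2.neg hP⟩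

lemma HasUniqueEquilibrium.neg [NullSingletonClass P] [NullSingletonClass P']
    (hP : MeasurePreserving (fun x : ℝ => -x) P' P) (hP' : MeasurePreserving (fun x : ℝ => -x) P P')
    {N : ℕ} (h : HasUniqueEquilibrium P b lo hi N) :
    HasUniqueEquilibrium P' (-b) (-hi) (-lo) N := by
  obtain ⟨q, hq, huniq⟩ := h
  refine ⟨(fun i => -q.1 i.rev, fun k => -q.2 k.rev), hq.neg hP, fun r hr => ?_⟩
  have h1 := hr.neg hP'
  rw [neg_neg, neg_neg, neg_neg] at h1
  rw [← huniq (fun i => -r.1 i.rev, fun k => -r.2 k.rev) h1]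
  simp

lemma IsBinBound.neg [NullSingletonClass P] [NullSingletonClass P']
    (hP : MeasurePreserving (fun x : ℝ => -x) P' P) (hP' : MeasurePreserving (fun x : ℝ => -x) P P')
    {N : ℕ} (h : IsBinBound P b lo hi N) : IsBinBound P' (-b) (-hi) (-lo) N := by
  refine ⟨fun γe γd hN => ?_, fun n m u hmu => ?_⟩
  · have h1 := hN.neg hP'
    rw [neg_neg] at h1
    obtain ⟨n, m, u, hmu⟩ := h.1 _ _ h1
    have h2 := hmu.neg hP
    simp only [neg_neg] at h2
    exact ⟨n, _, _, h2⟩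
  · have h1 := hmu.neg hP'
    rw [neg_neg, neg_neg, neg_neg] at h1
    exact h.2 _ _ _ h1

variable {f : ℝ → ℝ}

lemma IsLogConcaveDensity.comp_neg (hf : IsLogConcaveDensity f) :
    IsLogConcaveDensity fun x => f (-x) := by
  refine ⟨fun x => hf.nonneg _, hf.measurable.comp measurable_neg, ?_, ?_⟩
  · rw [← hf.total_mass]
    exact (Measure.measurePreserving_neg (volume : Measure ℝ)).lintegral_comp_emb
      (MeasurableEquiv.neg ℝ).measurableEmbedding fun x => ENNReal.ofReal (f x)
  · exact hf.log_concave.comp_linearMap (-LinearMap.id)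

lemma measurePreserving_neg_sourceLaw (f : ℝ → ℝ) :
    MeasurePreserving (fun x : ℝ => -x) (sourceLaw fun x => f (-x)) (sourceLaw f) := by
  refine ⟨measurable_neg, Measure.ext fun s hs => ?_⟩
  rw [Measure.map_apply measurable_neg hs, sourceLaw, sourceLaw, withDensity_apply _ hs,
    withDensity_apply _ (measurable_neg hs)]
  exact (Measure.measurePreserving_neg (volume : Measure ℝ)).setLIntegral_comp_preimage_emb
    (MeasurableEquiv.neg ℝ).measurableEmbedding (fun x => ENNReal.ofReal (f x)) s

lemma nullSingletonClass_sourceLaw (f : ℝ → ℝ) : NullSingletonClass (sourceLaw f) :=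
  ⟨fun x => IsLogConcaveDensity.sourceLaw_absolutelyContinuous f (measure_singleton x)⟩

lemma tsupport_comp_neg {U : ℝ} (h : tsupport f = Iic U) :
    tsupport (fun x => f (-x)) = Ici (-U) := by
  have := tsupport_comp_eq_preimage f (Homeomorph.neg ℝ)
  rw [h] at this
  refine this.trans ?_
  ext x
  simp

end Reflection

theorem theorem4 (f : ℝ → ℝ) (hf : IsLogConcaveDensity f)
    (hmean : Integrable (fun x : ℝ => x) (sourceLaw f)) :
    (∀ mL : ℝ, tsupport f = Set.Ici mL →
      (∀ b : ℝ, 0 < b → ∀ N : ℕ, 1 ≤ N →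
        HasUniqueEquilibrium (sourceLaw f) b (mL : EReal) ⊤ N) ∧
      (∀ b : ℝ, b < 0 → ∃ Nmax : ℕ, 1 ≤ Nmax ∧
        IsBinBound (sourceLaw f) b (mL : EReal) ⊤ Nmax ∧
        ∀ N : ℕ, 1 ≤ N → N ≤ Nmax →
          HasUniqueEquilibrium (sourceLaw f) b (mL : EReal) ⊤ N)) ∧
    (∀ mU : ℝ, tsupport f = Set.Iic mU →
      (∀ b : ℝ, b < 0 → ∀ N : ℕ, 1 ≤ N →
        HasUniqueEquilibrium (sourceLaw f) b ⊥ (mU : EReal) N) ∧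
      (∀ b : ℝ, 0 < b → ∃ Nmax : ℕ, 1 ≤ Nmax ∧
        IsBinBound (sourceLaw f) b ⊥ (mU : EReal) Nmax ∧
        ∀ N : ℕ, 1 ≤ N → N ≤ Nmax →
          HasUniqueEquilibrium (sourceLaw f) b ⊥ (mU : EReal) N)) := by

  refine ⟨fun mL hL => ⟨fun b hb N hN => hasUniqueEquilibrium_of_pos hf hL hb hN,
    fun b hb => exists_binBound_of_neg hf hL hb⟩, fun mU hU => ?_⟩
  have hg := hf.comp_neg
  have hgL := tsupport_comp_neg hU
  have hP' := measurePreserving_neg_sourceLaw f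
  have hP := measurePreserving_neg_sourceLaw fun x => f (-x)
  simp only [neg_neg] at hP
  have := nullSingletonClass_sourceLaw f
  have := nullSingletonClass_sourceLaw fun x => f (-x)
  have huniq : ∀ {b : ℝ} {N : ℕ},
      HasUniqueEquilibrium (sourceLaw fun x => f (-x)) (-b) ((-mU : ℝ) : EReal) ⊤ N →
        HasUniqueEquilibrium (sourceLaw f) b ⊥ (mU : EReal) N := fun h => by
    have h1 := h.neg hP hP'
    rwa [neg_neg, EReal.neg_top, EReal.coe_neg, neg_neg] at h1
  refine ⟨fun b hb N hN => huniq (hasUniqueEquilibrium_of_pos hg hgL (by linarith) hN),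
    fun b hb => ?_⟩
  obtain ⟨Nmax, h1, h2, h3⟩ := exists_binBound_of_neg hg hgL (b := -b) (by linarith)
  refine ⟨Nmax, h1, ?_, fun N hN hle => huniq (h3 N hN hle)⟩
  have h4 := h2.neg hP hP'
  rwa [neg_neg, EReal.neg_top, EReal.coe_neg, neg_neg] at h4
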